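/- Let $\mathcal G$ be a class of finite labelled simple graphs, stable under isomorphism and block-stable: it contains the single edge, and a connected graph is in $\mathcal G$ if and only if each of its blocks (maximal 2-connected subgraphs; the single edge counts as 2-connected, the single vertex does not) is in $\mathcal G$. Let $\mathcal C$ and $\mathcal B$ be the families of connected and of 2-connected graphs in $\mathcal G$. A matched graph (resp. matched block) is a triple $(I,M,g)$ with $g\in\mathcal C$ (resp. $g\in\mathcal B$), $M$ a matching of $g$ and $I$ an independent set of $g$ none of whose vertices is incident with an edge of $M$. A vertex has type $0$ if it is in $I$, type $1$ if it is incident with $M$, and type $2$ (marginal) otherwise. Let $\bar C(x,z_0,z_1,z_2)$ and $\bar B(x,z_0,z_1,z_2)$ be the generating functions of matched graphs and matched blocks, exponential in $x$, where $x$ marks vertices and $z_i$ marks vertices of type $i$. For $i\in\{0,1,2\}$ let $\bar B_i(x,z_0,z_1,z_2)$ be the exponential generating function of matched blocks pointed at a vertex of type $i$, and let $\bar C_i(x,z_0,z_1)$ be the exponential generating function of connected matched graphs pointed at a vertex of type $i$ in which no vertex other than possibly the pointed one is marginal. Here pointing means distinguishing the vertex with the largest label, and the pointed vertex is marked neither by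 $x$ nor by any $z_j$. Then, as formal power series over $\mathbb Q$, for $i\in\{0,1,2\}$, $$x\,\bar B_i=\frac{\partial\bar B}{\partial z_i},\qquad x\,\bar C_i=\frac{\partial\bar C}{\partial z_i}(x,z_0,z_1,0);$$ the series $\bar B_0(x,z_0\bar C_0,z_1\bar C_2,z_1\bar C_1)$ and $\bar B_2(x,z_0\bar C_0,z_1\bar C_2,z_1\bar C_1)$ have constant term zero, so that their exponentials are well defined; and $$\begin{aligned} \bar C_0&=\exp\bigl(\bar B_0(x,z_0\bar C_0,z_1\bar C_2,z_1\bar C_1)\bigr),\\ \bar C_1&=\bar C_2\,\bar B_1(x,z_0\bar C_0,z_1\bar C_2,z_1\bar C_1),\\ \bar C_2&=\exp\bigl(\bar B_2(x,z_0\bar C_0,z_1\bar C_2,z_1\bar C_1)\bigr). \end{aligned}$$ -/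

import Mathlib

open scoped Nat

/-- A class of finite labelled simple graphs, stable under isomorphism. The vertices of a graph of
size `n` carry the labels `0, …, n - 1`. -/
structure GraphClass where
  mem : ∀ n : ℕ, SimpleGraph (Fin n) → Prop
  iso_mem : ∀ {m n : ℕ} (g : SimpleGraph (Fin m)) (h : SimpleGraph (Fin n)),
    Nonempty (g ≃g h) → mem m g → mem n h

/-- A graph on an arbitrary vertex type belongs to the class if it is isomorphic to a labelled
member. -/
def GraphClass.Mem (𝒢 : GraphClass) {V : Type} (g : SimpleGraph V) : Prop :=
  ∃ (n : ℕ) (h : SimpleGraph (Fin n)), 𝒢.mem n h ∧ Nonempty (g ≃g h)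

/-- 2-connected graphs in the sense of block decompositions: connected, with at least two vertices,
and without a cut vertex. The single edge is 2-connected, the single vertex is not. -/
def TwoConnected {V : Type} (g : SimpleGraph V) : Prop :=
  g.Connected ∧ Nontrivial V ∧ ∀ v : V, (g.induce {v}ᶜ).Connected

/-- A block of `g` is a maximal 2-connected subgraph of `g`. -/
def IsBlock {V : Type} (g : SimpleGraph V) (H : g.Subgraph) : Prop :=
  Maximal (fun K : g.Subgraph => TwoConnected K.coe) H

/-- Block-stable classes: the single edge is in the class, and a connected graph is in the class if
and only if each of its blocks is. -/
structure GraphClass.BlockStable (𝒢 : GraphClass) : Prop where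
  edge_mem : 𝒢.mem 2 ⊤
  mem_iff : ∀ (n : ℕ) (g : SimpleGraph (Fin n)), g.Connected →
    (𝒢.mem n g ↔ ∀ H : g.Subgraph, IsBlock g H → 𝒢.Mem H.coe)

/-- The 2-connected graphs (blocks) of the class. -/
def GraphClass.IsB (𝒢 : GraphClass) (n : ℕ) (g : SimpleGraph (Fin n)) : Prop :=
  𝒢.mem n g ∧ TwoConnected g

/-- The connected graphs of the class. -/
def GraphClass.IsC (𝒢 : GraphClass) (n : ℕ) (g : SimpleGraph (Fin n)) : Prop :=
  𝒢.mem n g ∧ g.Connected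

/-- A triple `(I, M, g)`: a graph with an independent set `I` and a matching `M` (given as the
subgraph whose edges are those of `M` and whose vertices are their end points) such that no vertex
of `I` is incident with an edge of `M`. -/
@[ext]
structure Matched (V : Type) where
  graph : SimpleGraph V
  I : Set V
  M : graph.Subgraph
  indep : graph.IsIndepSet I
  matching : M.IsMatching
  disj : Disjoint I M.verts

/-- The three vertex types: `0` is the independent set, `1` the matched vertices, `2` the marginal
vertices. -/
def Matched.part {V : Type} (s : Matched V) : Fin 3 → Set V :=
  ![s.I, s.M.verts, (s.I ∪ s.M.verts)ᶜ]

/-- There are finitely many matched graphs on a finite vertex set, so that the cardinalities below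
are genuine. -/
instance Matched.finite (V : Type) [Finite V] : Finite (Matched V) := by
  let f : Matched V → (SimpleGraph V × Set V × Set V × (V → V → Prop)) :=
    fun s => (s.graph, s.I, s.M.verts, s.M.Adj)
  refine Finite.of_injective f ?_
  rintro ⟨g, I, M, h1, h2, h3⟩ ⟨g', I', M', h1', h2', h3'⟩ h
  simp only [f, Prod.mk.injEq] at h
  obtain ⟨rfl, rfl, h4, h5⟩ := h
  obtain rfl : M = M' := SimpleGraph.Subgraph.ext h4 h5
  rfl

/-- The EGF of the matched graphs whose underlying graph satisfies `K`. The variables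
`0, 1, 2, 3` are `x, z₀, z₁, z₂`: `x` is exponential and marks all vertices, `zⱼ` marks the vertices
of type `j`. -/
noncomputable def matchedEGF (K : ∀ n : ℕ, SimpleGraph (Fin n) → Prop) :
    MvPowerSeries (Fin 4) ℚ :=
  fun e => (Nat.card {s : Matched (Fin (e 0)) // K (e 0) s.graph ∧
    ∀ j : Fin 3, (s.part j).ncard = e j.succ} : ℚ) / ((e 0)! : ℚ)

/-- The EGF of the pointed matched graphs whose underlying graph satisfies `K` and whose pointed
vertex has type `i`. The pointed vertex is the one with the largest label and it is discounted: it
is marked neither by `x` nor by any `zⱼ`. -/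
noncomputable def pointedEGF (K : ∀ n : ℕ, SimpleGraph (Fin n) → Prop) (i : Fin 3) :
    MvPowerSeries (Fin 4) ℚ :=
  fun e => (Nat.card {s : Matched (Fin (e 0 + 1)) // K (e 0 + 1) s.graph ∧
    Fin.last (e 0) ∈ s.part i ∧
    ∀ j : Fin 3, (s.part j \ {Fin.last (e 0)}).ncard = e j.succ} : ℚ) / ((e 0)! : ℚ)

/-- The series `f(x, z₀, z₁, 0)`: only the monomials of `f` without `z₂` are kept. -/
noncomputable def evalZ2Zero (f : MvPowerSeries (Fin 4) ℚ) : MvPowerSeries (Fin 3) ℚ :=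
  fun e => MvPowerSeries.coeff (e.mapDomain Fin.castSucc) f

/-- The EGF `B̄(x, z₀, z₁, z₂)` of matched blocks. -/
noncomputable def GraphClass.Bbar (𝒢 : GraphClass) : MvPowerSeries (Fin 4) ℚ :=
  matchedEGF 𝒢.IsB

/-- The EGF `B̄ᵢ(x, z₀, z₁, z₂)` of matched blocks pointed at a vertex of type `i`. -/
noncomputable def GraphClass.BbarPt (𝒢 : GraphClass) (i : Fin 3) : MvPowerSeries (Fin 4) ℚ :=
  pointedEGF 𝒢.IsB i

/-- The EGF `C̄(x, z₀, z₁, z₂)` of connected matched graphs. -/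
noncomputable def GraphClass.Cbar (𝒢 : GraphClass) : MvPowerSeries (Fin 4) ℚ :=
  matchedEGF 𝒢.IsC

/-- The EGF `C̄ᵢ(x, z₀, z₁)` of connected matched graphs pointed at a vertex of type `i` in which no
vertex other than possibly the pointed one is marginal. -/
noncomputable def GraphClass.CbarPt (𝒢 : GraphClass) (i : Fin 3) : MvPowerSeries (Fin 3) ℚ :=
  evalZ2Zero (pointedEGF 𝒢.IsC i)

/-- The arguments `(x, z₀ C̄₀, z₁ C̄₂, z₁ C̄₁)` substituted for `(x, z₀, z₁, z₂)`. -/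
noncomputable def GraphClass.args (𝒢 : GraphClass) : Fin 4 → MvPowerSeries (Fin 3) ℚ :=
  ![MvPowerSeries.X 0, MvPowerSeries.X 1 * 𝒢.CbarPt 0, MvPowerSeries.X 2 * 𝒢.CbarPt 2,
    MvPowerSeries.X 2 * 𝒢.CbarPt 1]

/-- The substitution of `args` is legitimate: all four series have constant term zero. -/
theorem GraphClass.hasSubst_args (𝒢 : GraphClass) : MvPowerSeries.HasSubst 𝒢.args := by
  apply MvPowerSeries.hasSubst_of_constantCoeff_zero
  intro s
  fin_cases s <;> simp [GraphClass.args]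

/-- The series `B̄ᵢ(x, z₀ C̄₀, z₁ C̄₂, z₁ C̄₁)`. -/
noncomputable def GraphClass.BbarSubst (𝒢 : GraphClass) (i : Fin 3) : MvPowerSeries (Fin 3) ℚ :=
  MvPowerSeries.subst 𝒢.args (𝒢.BbarPt i)

/-- The exponential of a power series (with constant term zero). -/
noncomputable def expSeries (f : MvPowerSeries (Fin 3) ℚ) : MvPowerSeries (Fin 3) ℚ :=
  PowerSeries.subst f (PowerSeries.exp ℚ)

/-! Let `r` be the root of a connected matched graph. Each component of the graph minus `r`, with
`r` put back, is a branch: a connected graph that stays connected when `r` is removed.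
Block-stability makes membership in the class a condition on the branches separately.

If `r` has type 0 or 2, it has the same type in all branches, so the graph is a set of branches and
its series is the exponential of the branch series. This is proved through the equation `C' = B' C`,
with `B` the branch series: split off the branch that contains a chosen vertex
(`conn_sum_eq_of_ne_one`, `derivative_egs_conn`, `egs_conn_eq_exp`). If `r` has type 1, its partner
lies in exactly one branch, and `r` is marginal in the rest; this gives a product with the series
for type 2 (`conn_sum_one`, `egs_conn_one`).

In a branch, `r` lies in exactly one block, and at every other vertex `w` of that block hangs an
arbitrary connected graph rooted at `w`. This structure is encoded by an idempotent map of the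
vertices to the block (`exists_isBlockRetraction`, `IsBlockRetraction.eq`). If `w` has type `a` in
the block and `b` in the attached graph, then either both are 0 or neither is, they are not both 1,
and the type of `w` in the whole is `min a b`. With `z₂ = 0`, a block vertex of type 0, 1, 2 is thus
replaced by `z₀ C̄₀`, `z₁ C̄₂`, `z₁ C̄₁`, which turns the block series into the branch series
(`sum_retractionSet`, `branch_seq_eq`, `substX_egs_branch`).

The counts are weighted sums with values in `ℚ⟦x, z₀, z₁⟧`, collected in exponential series in an
auxiliary variable for the vertices other than the root; `substX` finally puts `x` for that
variable. The derivative identities count pairs of a matched graph and a vertex of type `i` in two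
ways (`X_mul_pointedEGF`). -/

namespace SimpleGraph

/-! ### Connectedness and 2-connectedness of vertex sets. -/

variable {V V' : Type}

/-- The graph on the same vertices whose edges are those of `g` with both ends in `A`. -/
def within (g : SimpleGraph V) (A : Set V) : SimpleGraph V where
  Adj u v := g.Adj u v ∧ u ∈ A ∧ v ∈ A
  symm := ⟨fun _ _ h => ⟨h.1.symm, h.2.2, h.2.1⟩⟩
  loopless := ⟨fun _ h => g.irrefl h.1⟩

theorem within_adj {g : SimpleGraph V} {A : Set V} {u v : V} :
    (g.within A).Adj u v ↔ g.Adj u v ∧ u ∈ A ∧ v ∈ A := Iff.rfl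

theorem within_mono {g : SimpleGraph V} {A B : Set V} (h : A ⊆ B) : g.within A ≤ g.within B :=
  fun _ _ h' => ⟨h'.1, h h'.2.1, h h'.2.2⟩

theorem within_le (g : SimpleGraph V) (A : Set V) : g.within A ≤ g := fun _ _ h => h.1

theorem within_univ (g : SimpleGraph V) : g.within Set.univ = g := by
  ext u v; simp [within_adj]

theorem induce_within (g : SimpleGraph V) {A B : Set V} (h : B ⊆ A) :
    (g.within A).induce B = g.induce B := by
  ext u v
  simp only [induce_adj, within_adj]
  exact ⟨fun h' => h'.1, fun h' => ⟨h', h u.2, h v.2⟩⟩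

theorem Reachable.closed {g : SimpleGraph V} {P : V → Prop} (h : ∀ a b, g.Adj a b → P a → P b)
    {u v : V} (huv : g.Reachable u v) (hu : P u) : P v := by
  obtain ⟨p⟩ := huv
  induction p with
  | nil => exact hu
  | cons hadj _ ih => exact ih (h _ _ hadj hu)

theorem Reachable.mem_of_within {g : SimpleGraph V} {A : Set V} {u v : V}
    (h : (g.within A).Reachable u v) (hu : u ∈ A) : v ∈ A :=
  h.closed (P := (· ∈ A)) (fun _ _ (h' : (g.within A).Adj _ _) _ => h'.2.2) hu

/-- The set `A` induces a connected subgraph of `g`. -/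
def ConnOn (g : SimpleGraph V) (A : Set V) : Prop :=
  A.Nonempty ∧ ∀ u ∈ A, ∀ v ∈ A, (g.within A).Reachable u v

theorem connOn_of_base {g : SimpleGraph V} {A : Set V} {r : V} (hr : r ∈ A)
    (h : ∀ v ∈ A, (g.within A).Reachable v r) : g.ConnOn A :=
  ⟨⟨r, hr⟩, fun u hu v hv => (h u hu).trans (h v hv).symm⟩

theorem induce_connected_iff_connOn {g : SimpleGraph V} {A : Set V} :
    (g.induce A).Connected ↔ g.ConnOn A := by
  constructor
  · intro h
    refine ⟨Set.nonempty_coe_sort.1 h.nonempty, fun u hu v hv => ?_⟩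
    let f : g.induce A →g g.within A := ⟨Subtype.val, fun {a b} hab => ⟨hab, a.2, b.2⟩⟩
    exact (h.preconnected ⟨u, hu⟩ ⟨v, hv⟩).map f
  · rintro ⟨⟨a, ha⟩, h⟩
    have : Nonempty A := ⟨⟨a, ha⟩⟩
    refine ⟨fun u v => ?_⟩
    refine (h u u.2 v v.2).closed (P := fun x => ∃ hx : x ∈ A, (g.induce A).Reachable u ⟨x, hx⟩)
      ?_ ⟨u.2, Reachable.rfl⟩ |>.2
    rintro x y hxy ⟨hx, hr⟩
    exact ⟨hxy.2.2, hr.trans (Adj.reachable (by exact hxy.1))⟩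

theorem connected_iff_connOn_univ {g : SimpleGraph V} : g.Connected ↔ g.ConnOn Set.univ := by
  rw [← induce_connected_iff_connOn]
  exact (induceUnivIso g).connected_iff.symm

/-- The isomorphism between the subgraphs induced by a set and by its image under an embedding. -/
noncomputable def induceImageIso {h : SimpleGraph V} {g : SimpleGraph V'} (f : h ↪g g)
    (A : Set V) : h.induce A ≃g g.induce (f '' A) where
  toEquiv := Equiv.Set.image f A f.injective
  map_rel_iff' := by
    intro a b
    exact f.map_rel_iff'

theorem connOn_image {h : SimpleGraph V} {g : SimpleGraph V'} (f : h ↪g g) {A : Set V} :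
    g.ConnOn (f '' A) ↔ h.ConnOn A := by
  rw [← induce_connected_iff_connOn, ← induce_connected_iff_connOn]
  exact (induceImageIso f A).connected_iff.symm

/-- The set `X` induces a 2-connected subgraph of `g`. -/
def TwoConnOn (g : SimpleGraph V) (X : Set V) : Prop :=
  X.Nontrivial ∧ g.ConnOn X ∧ ∀ v ∈ X, g.ConnOn (X \ {v})

theorem twoConnected_induce_iff {g : SimpleGraph V} {X : Set V} :
    TwoConnected (g.induce X) ↔ g.TwoConnOn X := by
  have key : ∀ v : X, ((g.induce X).induce {v}ᶜ).Connected ↔ g.ConnOn (X \ {v.1}) := by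
    intro v
    rw [induce_connected_iff_connOn, ← connOn_image (Embedding.induce X)]
    congr! 1
    ext x
    simp [Subtype.ext_iff, and_comm]
  unfold TwoConnected TwoConnOn
  rw [induce_connected_iff_connOn, Set.nontrivial_coe_sort]
  simp only [key]
  constructor
  · rintro ⟨h1, h2, h3⟩
    exact ⟨h2, h1, fun v hv => h3 ⟨v, hv⟩⟩
  · rintro ⟨h1, h2, h3⟩
    exact ⟨h2, h1, fun v => h3 v.1 v.2⟩

theorem twoConnOn_image {h : SimpleGraph V} {g : SimpleGraph V'} (f : h ↪g g) {A : Set V} :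
    g.TwoConnOn (f '' A) ↔ h.TwoConnOn A := by
  have key : ∀ v, f '' A \ {f v} = f '' (A \ {v}) := fun v => by
    rw [Set.image_sdiff f.injective, Set.image_singleton]
  unfold TwoConnOn
  rw [connOn_image, Set.image_nontrivial f.injective]
  simp [key, connOn_image]

theorem twoConnected_iff_twoConnOn_univ {g : SimpleGraph V} :
    TwoConnected g ↔ g.TwoConnOn Set.univ := by
  unfold TwoConnected TwoConnOn
  rw [connected_iff_connOn_univ, Set.nontrivial_univ_iff]
  simp only [induce_connected_iff_connOn, Set.compl_eq_univ_sdiff, Set.mem_univ, true_imp_iff]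
  tauto

theorem ConnOn.congr {g h : SimpleGraph V} {A : Set V} (e : g.induce A = h.induce A) :
    g.ConnOn A ↔ h.ConnOn A := by
  rw [← induce_connected_iff_connOn, ← induce_connected_iff_connOn, e]

theorem TwoConnOn.congr {g h : SimpleGraph V} {A : Set V} (e : g.induce A = h.induce A) :
    g.TwoConnOn A ↔ h.TwoConnOn A := by
  rw [← twoConnected_induce_iff, ← twoConnected_induce_iff, e]

end SimpleGraph

/-! ### Blocks as maximal 2-connected vertex sets, and block-stable classes. -/

section

open SimpleGraph

theorem TwoConnected.mono {V : Type} {g h : SimpleGraph V} (hgh : g ≤ h) (hg : TwoConnected g) :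
    TwoConnected h :=
  ⟨hg.1.mono hgh, hg.2.1, fun v => (hg.2.2 v).mono fun _ _ hab => hgh hab⟩

/-- Adding edges keeps a graph 2-connected, so the vertex set of a larger 2-connected subgraph is
again 2-connected in `g`, and maximality among vertex sets applies. -/
theorem isBlock_induce {V : Type} {g : SimpleGraph V} {X : Set V}
    (hX : Maximal g.TwoConnOn X) : IsBlock g ((⊤ : g.Subgraph).induce X) := by
  refine ⟨?_, fun K hK hle => ?_⟩
  · have := twoConnected_induce_iff.2 hX.1
    rwa [induce_eq_coe_induce_top] at this
  · have h1 : g.TwoConnOn K.verts :=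
      twoConnected_induce_iff.1 (TwoConnected.mono (fun a b (hab : K.Adj a b) => hab.adj_sub) hK)
    have h2 : K.verts ⊆ X := hX.2 h1 hle.1
    refine ⟨h2, fun a b hab => ?_⟩
    simp only [Subgraph.induce_adj, Subgraph.top_adj]
    exact ⟨h2 hab.fst_mem, h2 hab.snd_mem, hab.adj_sub⟩

/-- Filling in all edges of `g` gives a 2-connected subgraph, so a maximal one is already induced.
Blocks can therefore be handled as vertex sets. -/
theorem IsBlock.eq_induce {V : Type} {g : SimpleGraph V} {H : g.Subgraph} (hH : IsBlock g H) :
    H = (⊤ : g.Subgraph).induce H.verts ∧ Maximal g.TwoConnOn H.verts := by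
  have h0 : g.TwoConnOn H.verts :=
    twoConnected_induce_iff.1 (TwoConnected.mono (fun a b (hab : H.Adj a b) => hab.adj_sub) hH.1)
  have big : ∀ X, g.TwoConnOn X → H.verts ⊆ X → (⊤ : g.Subgraph).induce X ≤ H := by
    intro X hX hle
    refine hH.2 ?_ ⟨hle, fun a b hab => ?_⟩
    · have := twoConnected_induce_iff.2 hX
      rwa [induce_eq_coe_induce_top] at this
    · simp only [Subgraph.induce_adj, Subgraph.top_adj]
      exact ⟨hle hab.fst_mem, hle hab.snd_mem, hab.adj_sub⟩
  refine ⟨le_antisymm (show _ ∧ _ from ⟨le_rfl, fun a b hab => ?_⟩) (big _ h0 le_rfl), h0,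
    fun X hX hle => ?_⟩
  · simp only [Subgraph.induce_adj, Subgraph.top_adj]
    exact ⟨hab.fst_mem, hab.snd_mem, hab.adj_sub⟩
  · exact (big X hX hle).1

namespace GraphClass

variable {𝒢 : GraphClass} {V V' : Type}

theorem Mem.of_iso {g : SimpleGraph V} {h : SimpleGraph V'} (e : g ≃g h) (hg : 𝒢.Mem g) :
    𝒢.Mem h := by
  obtain ⟨n, k, hk, ⟨e'⟩⟩ := hg
  exact ⟨n, k, hk, ⟨e.symm.trans e'⟩⟩

theorem mem_congr {g : SimpleGraph V} {h : SimpleGraph V'} (e : g ≃g h) :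
    𝒢.Mem g ↔ 𝒢.Mem h := ⟨Mem.of_iso e, Mem.of_iso e.symm⟩

theorem mem_fin_iff {n : ℕ} {g : SimpleGraph (Fin n)} : 𝒢.Mem g ↔ 𝒢.mem n g := by
  constructor
  · rintro ⟨m, k, hk, ⟨e⟩⟩
    exact 𝒢.iso_mem k g ⟨e.symm⟩ hk
  · intro h
    exact ⟨n, g, h, ⟨Iso.refl⟩⟩

theorem maximal_image_iff {h : SimpleGraph V} {g : SimpleGraph V'} (f : h ↪g g) {X : Set V} :
    Maximal (fun Y => g.TwoConnOn Y ∧ Y ⊆ Set.range f) (f '' X) ↔ Maximal h.TwoConnOn X := by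
  constructor
  · rintro ⟨⟨h1, -⟩, h2⟩
    refine ⟨(twoConnOn_image f).1 h1, fun Y hY hle => ?_⟩
    have := h2 (y := f '' Y) ⟨(twoConnOn_image f).2 hY, Set.image_subset_range _ _⟩
      (Set.image_mono hle)
    exact (Set.image_subset_image_iff f.injective).1 this
  · rintro ⟨h1, h2⟩
    refine ⟨⟨(twoConnOn_image f).2 h1, Set.image_subset_range _ _⟩, ?_⟩
    rintro Y ⟨hY, hr⟩ hle
    obtain ⟨Y, rfl⟩ := Set.subset_range_iff_exists_image_eq.1 hr
    exact Set.image_mono (h2 ((twoConnOn_image f).1 hY)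
      ((Set.image_subset_image_iff f.injective).1 hle))

/-- Block-stability speaks of graphs on `Fin n`; a labelling of `A` carries it over to vertex sets,
where the blocks of the piece are the maximal 2-connected subsets of `A`. -/
theorem BlockStable.mem_induce_iff [Finite V] (h𝒢 : 𝒢.BlockStable) {g : SimpleGraph V} {A : Set V}
    (hA : g.ConnOn A) : 𝒢.Mem (g.induce A) ↔
      ∀ X, Maximal (fun Y => g.TwoConnOn Y ∧ Y ⊆ A) X → 𝒢.Mem (g.induce X) := by
  obtain ⟨n, ⟨e⟩⟩ := Finite.exists_equiv_fin A
  let h : SimpleGraph (Fin n) := (g.induce A).comap e.symm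
  let i : h ≃g g.induce A := ⟨e.symm, Iff.rfl⟩
  let f : h ↪g g := (Embedding.induce A).comp i.toEmbedding
  have hf : Set.range f = A := by
    ext x
    simp only [Set.mem_range]
    constructor
    · rintro ⟨y, rfl⟩
      exact (i y).2
    · intro hx
      refine ⟨i.symm ⟨x, hx⟩, ?_⟩
      change ((i (i.symm ⟨x, hx⟩) : A) : V) = x
      simp
  have hc : h.Connected := i.connected_iff.2 (induce_connected_iff_connOn.2 hA)
  rw [← mem_congr i, mem_fin_iff, h𝒢.mem_iff n h hc]
  rw [← hf]
  constructor
  · intro H X hX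
    obtain ⟨Y, rfl⟩ := Set.subset_range_iff_exists_image_eq.1 hX.1.2
    rw [maximal_image_iff] at hX
    have := H _ (isBlock_induce hX)
    rw [← mem_congr (induceImageIso f Y), induce_eq_coe_induce_top]
    exact this
  · intro H K hK
    obtain ⟨h1, h2⟩ := hK.eq_induce
    have := H _ ((maximal_image_iff f).2 h2)
    rw [← mem_congr (induceImageIso f _), induce_eq_coe_induce_top] at this
    rw [h1]
    exact this

/-- Membership in a block-stable class can be tested on the members of a cover of the vertices by
connected pieces that meet in at most one vertex, as soon as each 2-connected subgraph lies in a
piece. -/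
theorem BlockStable.mem_iff_cover [Finite V] (h𝒢 : 𝒢.BlockStable) {g : SimpleGraph V} {J : Type*}
    {A : J → Set V} (hg : g.ConnOn Set.univ) (hA : ∀ j, g.ConnOn (A j))
    (hcov : ∀ X, g.TwoConnOn X → ∃ j, X ⊆ A j)
    (hsub : ∀ j k, j ≠ k → (A j ∩ A k).Subsingleton) :
    𝒢.Mem (g.induce Set.univ) ↔ ∀ j, 𝒢.Mem (g.induce (A j)) := by
  rw [h𝒢.mem_induce_iff hg]
  simp only [h𝒢.mem_induce_iff (hA _)]
  constructor
  · intro H j X hX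
    refine H X ⟨⟨hX.1.1, Set.subset_univ _⟩, ?_⟩
    rintro Y ⟨hY, -⟩ hXY
    obtain ⟨k, hk⟩ := hcov Y hY
    -- A 2-connected set has two vertices, and distinct pieces share at most one.
    obtain rfl : j = k := by
      by_contra hne
      exact Set.not_subsingleton_iff.2 hX.1.1.1
        ((hsub j k hne).anti fun x hx => ⟨hX.1.2 hx, hk (hXY hx)⟩)
    exact hX.2 ⟨hY, hk⟩ hXY
  · intro H X hX
    obtain ⟨j, hj⟩ := hcov X hX.1.1
    exact H j X ⟨⟨hX.1.1, hj⟩, fun Y hY hXY => hX.2 ⟨hY.1, Set.subset_univ _⟩ hXY⟩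

end GraphClass

/-- A piece that is attached to the rest of the graph at a single vertex `w` contains each
2-connected subgraph that meets it in another vertex. -/
theorem SimpleGraph.TwoConnOn.subset_of_attached {V : Type} {g : SimpleGraph V} {X T : Set V}
    {w u : V} (hX : g.TwoConnOn X) (hw : w ∈ T)
    (hT : ∀ a b, g.Adj a b → a ∈ T → a ≠ w → b ∈ T) (hu : u ∈ X) (huT : u ∈ T) (huw : u ≠ w) :
    X ⊆ T := by
  intro x hx
  by_cases hxw : x = w
  · exact hxw ▸ hw
  have : g.ConnOn (X \ {w}) := by
    by_cases hwX : w ∈ X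
    · exact hX.2.2 w hwX
    · rw [Set.sdiff_singleton_eq_self hwX]
      exact hX.2.1
  refine (this.2 u ⟨hu, huw⟩ x ⟨hx, hxw⟩).closed (P := (· ∈ T)) ?_ huT
  rintro a b ⟨hab, ha, -⟩ haT
  exact hT a b hab haT ha.2

end

/-! ### Branches at a vertex. -/

namespace SimpleGraph

variable {V : Type}

theorem Walk.reachable_within {g : SimpleGraph V} {B : Set V} {u v : V} (p : g.Walk u v)
    (hp : ∀ x ∈ p.support, x ∈ B) : (g.within B).Reachable u v := by
  induction p with
  | nil => exact Reachable.rfl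
  | @cons a b c hab q ih =>
    have hb : b ∈ B := hp b (by simp)
    have ha : a ∈ B := hp a (by simp)
    exact (Adj.reachable (show (g.within B).Adj a b from ⟨hab, ha, hb⟩)).trans
      (ih fun x hx => hp x (by simp [hx]))

theorem ConnOn.extend {g : SimpleGraph V} {X Y : Set V} (hX : g.ConnOn X) (hXY : X ⊆ Y)
    (h : ∀ u ∈ Y, ∃ x ∈ X, (g.within Y).Reachable u x) : g.ConnOn Y := by
  obtain ⟨a, ha⟩ := hX.1
  refine connOn_of_base (hXY ha) fun u hu => ?_
  obtain ⟨x, hx, hux⟩ := h u hu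
  exact hux.trans ((hX.2 x hx a ha).mono (within_mono hXY))

theorem ConnOn.insert {g : SimpleGraph V} {A : Set V} {r a : V} (hA : g.ConnOn A) (ha : a ∈ A)
    (h : g.Adj r a) : g.ConnOn (insert r A) := by
  refine hA.extend (Set.subset_insert _ _) ?_
  rintro u (rfl | hu)
  · exact ⟨a, ha, Adj.reachable ⟨h, Set.mem_insert _ _, Set.mem_insert_of_mem _ ha⟩⟩
  · exact ⟨u, hu, Reachable.rfl⟩

/-- Adding a path between two vertices of a 2-connected subgraph keeps it 2-connected. -/
theorem TwoConnOn.union_path {g : SimpleGraph V} {H : Set V} (hH : g.TwoConnOn H) {a b : V}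
    (ha : a ∈ H) (hb : b ∈ H) (p : g.Walk a b) (hp : p.IsPath) :
    g.TwoConnOn (H ∪ {x | x ∈ p.support}) := by
  classical
  refine ⟨hH.1.mono Set.subset_union_left, hH.2.1.extend Set.subset_union_left ?_, ?_⟩
  · rintro u (hu | hu)
    · exact ⟨u, hu, Reachable.rfl⟩
    · refine ⟨b, hb, (p.dropUntil u hu).reachable_within fun x hx => Or.inr ?_⟩
      exact p.support_dropUntil_subset_support hu hx
  · intro v _
    have hHv : g.ConnOn (H \ {v}) := by
      by_cases hv : v ∈ H
      · exact hH.2.2 v hv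
      · rw [Set.sdiff_singleton_eq_self hv]
        exact hH.2.1
    refine hHv.extend (Set.sdiff_subset_sdiff_left Set.subset_union_left) ?_
    rintro u ⟨hu | hu, huv⟩
    · exact ⟨u, ⟨hu, huv⟩, Reachable.rfl⟩
    · have huv : u ≠ v := huv
      -- The path is simple and `v ≠ u`, so `v` lies on at most one side of `u`. Following `p` from
      -- `u` to the end on the other side reaches a vertex of `H` other than `v`.
      by_cases h1 : v ∈ (p.takeUntil u hu).support
      · have h2 : v ∉ (p.dropUntil u hu).support := by
          intro h2
          have hn := hp.support_nodup
          rw [← p.take_spec hu, Walk.support_append] at hn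
          rw [← Walk.cons_tail_support] at h2
          rcases List.mem_cons.1 h2 with h2 | h2
          · exact huv h2.symm
          · exact List.disjoint_of_nodup_append hn h1 h2
        refine ⟨b, ⟨hb, ?_⟩, (p.dropUntil u hu).reachable_within fun x hx => ⟨Or.inr ?_, ?_⟩⟩
        · rintro rfl
          exact h2 (Walk.end_mem_support _)
        · exact p.support_dropUntil_subset_support hu hx
        · rintro rfl
          exact h2 hx
      · refine ⟨a, ⟨ha, ?_⟩, Reachable.symm <|
          (p.takeUntil u hu).reachable_within fun x hx => ⟨Or.inr ?_, ?_⟩⟩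
        · rintro rfl
          exact h1 (Walk.start_mem_support _)
        · exact p.support_takeUntil_subset_support hu hx
        · rintro rfl
          exact h1 hx

theorem Adj.twoConnOn_pair {g : SimpleGraph V} {u v : V} (h : g.Adj u v) :
    g.TwoConnOn {u, v} := by
  have single : ∀ x : V, g.ConnOn {x} := fun x =>
    connOn_of_base rfl fun y hy => by rw [Set.mem_singleton_iff.1 hy]
  refine ⟨Set.nontrivial_pair h.ne, (single v).insert rfl h, ?_⟩
  rintro w (rfl | rfl)
  · convert single v using 1
    ext x
    simp only [Set.mem_sdiff, Set.mem_insert_iff, Set.mem_singleton_iff]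
    exact ⟨fun hx => hx.1.resolve_left hx.2, fun hx => ⟨Or.inr hx, fun h' => h.ne (h' ▸ hx)⟩⟩
  · convert single u using 1
    ext x
    simp only [Set.mem_sdiff, Set.mem_insert_iff, Set.mem_singleton_iff]
    exact ⟨fun hx => hx.1.resolve_right hx.2, fun hx => ⟨Or.inl hx, fun h' => h.ne (hx ▸ h')⟩⟩

/-- `A` is a branch of `g` at `r`: a connected component of `g - r` adjacent to `r`, such that the
rest of the graph is connected. -/
structure IsBranch (g : SimpleGraph V) (r : V) (A : Set V) : Prop where
  root : r ∉ A
  edge : ∀ a b, g.Adj a b → a ∈ A → b ≠ r → b ∈ A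
  conn : g.ConnOn A
  conn_insert : g.ConnOn (insert r A)
  conn_compl : g.ConnOn Aᶜ

theorem exists_isBranch {g : SimpleGraph V} (hg : g.ConnOn Set.univ) {r u : V} (hur : u ≠ r) :
    ∃ A, u ∈ A ∧ g.IsBranch r A := by
  have hg' : ∀ a b, g.Reachable a b := fun a b => by
    have := hg.2 a trivial b trivial
    rwa [within_univ] at this
  let A : Set V := {v | (g.within {r}ᶜ).Reachable u v}
  have huA : u ∈ A := Reachable.rfl
  have hr : r ∉ A := fun h => Reachable.mem_of_within h hur rfl
  have edge : ∀ a b, g.Adj a b → a ∈ A → b ≠ r → b ∈ A := by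
    intro a b hab ha hb
    refine Reachable.trans ha (Adj.reachable ⟨hab, ?_, hb⟩)
    rintro rfl
    exact hr ha
  have conn : g.ConnOn A := by
    refine connOn_of_base huA fun v hv => Reachable.symm ?_
    have := (show (g.within {r}ᶜ).Reachable u v from hv).closed
      (P := fun x => x ∈ A ∧ (g.within A).Reachable u x) ?_ ⟨huA, Reachable.rfl⟩
    · exact this.2
    · rintro a b hab ⟨ha, hua⟩
      have hb := edge a b hab.1 ha hab.2.2
      exact ⟨hb, hua.trans (Adj.reachable ⟨hab.1, ha, hb⟩)⟩
  refine ⟨A, huA, hr, edge, conn, ?_, ?_⟩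
  -- Without an edge from `A` to `r`, the set `A` would be closed under adjacency, and connectedness
  -- would put `r` into it.
  · obtain ⟨a, ha, har⟩ : ∃ a ∈ A, g.Adj r a := by
      by_contra hcon
      push Not at hcon
      refine hr ((hg' u r).closed (P := (· ∈ A)) (fun a b hab ha => edge a b hab ha ?_) huA)
      rintro rfl
      exact hcon a ha hab.symm
    exact conn.insert ha har
  -- A walk from outside `A` to `r` can enter `A` only through `r`, so up to its first visit to `r`
  -- it stays in the complement.
  · refine connOn_of_base hr fun v hv => ?_
    obtain ⟨p⟩ := hg' v r
    clear conn huA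
    induction p with
    | nil => exact Reachable.rfl
    | @cons a b c hab q ih =>
      by_cases hac : a = c
      · rw [hac]
      · have hb : b ∈ Aᶜ := fun hb => hv (edge b a hab.symm hb hac)
        exact (Adj.reachable (show (g.within Aᶜ).Adj a b from ⟨hab, hv, hb⟩)).trans
          (ih hur hr edge hb)

namespace IsBranch

variable {g : SimpleGraph V} {r : V} {A B : Set V}

theorem subset_of_mem (hA : g.IsBranch r A) (hB : g.IsBranch r B) {u : V} (hu : u ∈ A)
    (huB : u ∈ B) : A ⊆ B := by
  intro x hx
  refine (hA.conn.2 u hu x hx).closed (P := (· ∈ B)) ?_ huB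
  rintro a b ⟨hab, -, hb⟩ ha
  exact hB.edge a b hab ha fun h => hA.root (h ▸ hb)

theorem eq_of_mem (hA : g.IsBranch r A) (hB : g.IsBranch r B) {u : V} (hu : u ∈ A)
    (huB : u ∈ B) : A = B :=
  (hA.subset_of_mem hB hu huB).antisymm (hB.subset_of_mem hA huB hu)

theorem connOn_univ (hA : g.IsBranch r A) : g.ConnOn Set.univ := by
  refine connOn_of_base (Set.mem_univ r) fun v _ => ?_
  by_cases hv : v ∈ A
  · exact (hA.conn_insert.2 v (Or.inr hv) r (Or.inl rfl)).mono (within_mono (Set.subset_univ _))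
  · exact (hA.conn_compl.2 v hv r hA.root).mono (within_mono (Set.subset_univ _))

/-- The two pieces meet only in `r`. A 2-connected set with a vertex in `A` lies in `insert r A`,
because `A` is attached at `r` alone. -/
theorem mem_iff [Finite V] {𝒢 : GraphClass} (h𝒢 : 𝒢.BlockStable) (hA : g.IsBranch r A) :
    𝒢.Mem (g.induce Set.univ) ↔ 𝒢.Mem (g.induce (insert r A)) ∧ 𝒢.Mem (g.induce Aᶜ) := by
  rw [h𝒢.mem_iff_cover (J := Bool) (A := fun j => if j then insert r A else Aᶜ) hA.connOn_univ]
  · simp [and_comm]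
  · rintro (_ | _)
    · simpa using hA.conn_compl
    · simpa using hA.conn_insert
  · intro X hX
    by_cases h : ∃ u ∈ X, u ∈ A
    · obtain ⟨u, hu, huA⟩ := h
      refine ⟨true, hX.subset_of_attached (w := r) (by simp) ?_ hu (by simp [huA]) ?_⟩
      · rintro a b hab ha har
        simp only [if_true, Set.mem_insert_iff] at ha ⊢
        by_cases hb : b = r
        · exact Or.inl hb
        · exact Or.inr (hA.edge a b hab (ha.resolve_left har) hb)
      · rintro rfl
        exact hA.root huA
    · push Not at h
      exact ⟨false, fun x hx => by simpa using h x hx⟩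
  · have key : (insert r A ∩ Aᶜ).Subsingleton := by
      rintro x ⟨rfl | hx, hx'⟩ y ⟨rfl | hy, hy'⟩
      · rfl
      · exact absurd hy hy'
      · exact absurd hx hx'
      · exact absurd hx hx'
    rintro (_ | _) (_ | _) hjk
    · exact absurd rfl hjk
    · rw [Set.inter_comm]
      simpa using key
    · simpa using key
    · exact absurd rfl hjk

end IsBranch

/-! ### The block at a root that is not a cut vertex, and the retraction to it. -/

/-- `ρ` retracts `g` to the unique block containing `r`, where `r` is not a cut vertex: each vertex
is mapped to the vertex of the block to which its part of the graph is attached. -/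
structure IsBlockRetraction (g : SimpleGraph V) (r : V) (ρ : V → V) : Prop where
  idem : ∀ v, ρ (ρ v) = ρ v
  root : ∀ v, ρ v = r ↔ v = r
  block : g.TwoConnOn {v | ρ v = v}
  fiber : ∀ w, ρ w = w → g.ConnOn {v | ρ v = w}
  edge : ∀ a b, g.Adj a b → (ρ a = a ∧ ρ b = b) ∨ ρ a = ρ b

/-- Take a maximal 2-connected set `H` containing an edge at `r`, and let `k` be `g` without the
edges inside `H`. Each component of `k` meets `H` in exactly one vertex, and `ρ` sends the component
there. -/
theorem exists_isBlockRetraction [Finite V] {g : SimpleGraph V} {r : V} (hg : g.ConnOn Set.univ)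
    (hr : g.ConnOn {r}ᶜ) : ∃ ρ, g.IsBlockRetraction r ρ := by
  have hg' : ∀ a b, g.Reachable a b := fun a b => by
    have := hg.2 a trivial b trivial
    rwa [within_univ] at this
  obtain ⟨y, hy⟩ := hr.1
  obtain ⟨u, hu⟩ : ∃ u, g.Adj r u := by
    by_contra hcon
    push Not at hcon
    exact hy ((hg' r y).closed (P := (· = r)) (fun a b hab ha => absurd (ha ▸ hab) (hcon b)) rfl)
  obtain ⟨H, hle, hH⟩ := (Set.toFinite {X | g.TwoConnOn X}).exists_le_maximal hu.twoConnOn_pair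
  have hrH : r ∈ H := hle (by simp)
  have huH : u ∈ H := hle (by simp)
  have hH1 : g.TwoConnOn H := hH.1
  let k : SimpleGraph V :=
    { Adj := fun a b => g.Adj a b ∧ ¬ (a ∈ H ∧ b ∈ H)
      symm := ⟨fun a b h => ⟨h.1.symm, fun h' => h.2 ⟨h'.2, h'.1⟩⟩⟩
      loopless := ⟨fun a h => g.irrefl h.1⟩ }
  have hkg : k ≤ g := fun a b h => h.1
  have hit : ∀ g₀ ≤ g, ∀ v x, g₀.Reachable v x → x ∈ H →
      ∃ w ∈ H, k.Reachable v w ∧ g₀.Reachable v w := by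
    rintro g₀ hle v x ⟨p⟩ hx
    induction p with
    | nil => exact ⟨_, hx, Reachable.rfl, Reachable.rfl⟩
    | @cons a b c hab q ih =>
      by_cases ha : a ∈ H
      · exact ⟨a, ha, Reachable.rfl, Reachable.rfl⟩
      · obtain ⟨w, hw, h1, h2⟩ := ih hx
        exact ⟨w, hw, (Adj.reachable (show k.Adj a b from ⟨hle hab, fun h => ha h.1⟩)).trans h1,
          hab.reachable.trans h2⟩
  -- Adding a path of `k` between two vertices of `H` keeps `H` 2-connected, so by maximality the
  -- path lies in `H`. Its first edge then has both ends in `H`, which `k` forbids.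
  have uniq : ∀ w ∈ H, ∀ w' ∈ H, k.Reachable w w' → w = w' := by
    intro w hw w' hw' h
    by_contra hne
    obtain ⟨p, hp⟩ := h.exists_isPath
    have hsub : H ∪ {x | x ∈ (p.mapLe hkg).support} ⊆ H :=
      hH.2 (hH1.union_path hw hw' (p.mapLe hkg) (hp.mapLe hkg)) Set.subset_union_left
    cases p with
    | nil => exact hne rfl
    | @cons _ b _ hab q =>
      exact hab.2 ⟨hw, hsub (Or.inr (by simp))⟩
  have ex : ∀ v, ∃ w ∈ H, k.Reachable v w := fun v => by
    obtain ⟨w, hw, h, -⟩ := hit g le_rfl v r (hg' v r) hrH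
    exact ⟨w, hw, h⟩
  choose ρ hρH hρ using ex
  have ρ_eq : ∀ v w, w ∈ H → k.Reachable v w → ρ v = w := fun v w hw h =>
    uniq _ (hρH v) _ hw ((hρ v).symm.trans h)
  have fix : ∀ v, ρ v = v ↔ v ∈ H := fun v =>
    ⟨fun h => h ▸ hρH v, fun h => ρ_eq v v h Reachable.rfl⟩
  refine ⟨ρ, fun v => (fix _).2 (hρH v), fun v => ⟨fun h => ?_, ?_⟩, ?_, ?_, ?_⟩
  -- Since `r` is not a cut vertex, a walk avoiding `r` leads from `v` to `u`. Its first vertex in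
  -- `H` must be `ρ v`, so `ρ v` is not `r`.
  · by_contra hv
    obtain ⟨w, hw, h1, h2⟩ := hit _ (within_le g _) v u (hr.2 v hv u hu.ne') huH
    exact h2.mem_of_within hv ((ρ_eq v w hw h1).symm.trans h)
  · rintro rfl
    exact (fix _).2 hrH
  · convert hH1 using 1
    ext v
    exact fix v
  · intro w hw
    refine connOn_of_base hw fun v hv => ?_
    have := (hρ v).closed (P := fun x => ρ x = w ∧ (g.within {v | ρ v = w}).Reachable v x) ?_
      ⟨hv, Reachable.rfl⟩
    · rw [show ρ v = w from hv] at this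
      exact this.2
    · rintro a b hab ⟨ha, hva⟩
      have hb : ρ b = w :=
        ρ_eq _ _ ((fix w).1 hw) ((Adj.reachable hab.symm).trans (ha ▸ hρ a))
      exact ⟨hb, hva.trans (Adj.reachable ⟨hab.1, ha, hb⟩)⟩
  · intro a b hab
    by_cases h : a ∈ H ∧ b ∈ H
    · exact Or.inl ⟨(fix a).2 h.1, (fix b).2 h.2⟩
    · exact Or.inr (ρ_eq a _ (hρH b) ((Adj.reachable (show k.Adj a b from ⟨hab, h⟩)).trans (hρ b)))

namespace IsBlockRetraction

variable {g : SimpleGraph V} {r : V} {ρ τ : V → V}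

theorem mem_fiber (hρ : g.IsBlockRetraction r ρ) {a b w : V} (hab : g.Adj a b) (ha : ρ a = w)
    (haw : a ≠ w) : ρ b = w := by
  rcases hρ.edge a b hab with h | h
  · exact absurd (h.1.symm.trans ha) haw
  · exact h.symm.trans ha

theorem subset_fiber (hρ : g.IsBlockRetraction r ρ) {X : Set V} (hX : g.TwoConnOn X) {u : V}
    (hu : u ∈ X) (hne : ρ u ≠ u) : X ⊆ {v | ρ v = ρ u} :=
  hX.subset_of_attached (hρ.idem u) (fun _ _ hab ha haw => hρ.mem_fiber hab ha haw) hu rfl hne.symm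

/-- If `τ` moved a vertex `v` of the block of `ρ`, this whole block, with `r` in it, would lie in
the fiber of `τ v`. Then `τ v = r`, which only `v = r` allows. -/
theorem fix_of_fix (hρ : g.IsBlockRetraction r ρ) (hτ : g.IsBlockRetraction r τ) {v : V}
    (hv : ρ v = v) : τ v = v := by
  by_contra hne
  have h := hτ.subset_fiber hρ.block hv hne ((hρ.root r).2 rfl)
  have h1 : τ v = r := Eq.trans (Eq.symm h) ((hτ.root r).2 rfl)
  have h2 := (hτ.root v).1 h1
  exact hne (h1.trans h2.symm)

/-- Both maps have the same fixed points. A fiber of `ρ` is connected and contains only one of them,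
so no edge inside it joins two fixed points and `τ` is constant on it. -/
theorem eq (hρ : g.IsBlockRetraction r ρ) (hτ : g.IsBlockRetraction r τ) : ρ = τ := by
  funext v
  have hw : τ (ρ v) = ρ v := hρ.fix_of_fix hτ (hρ.idem v)
  refine hw.symm.trans ?_
  refine ((hρ.fiber (ρ v) (hρ.idem v)).2 v rfl (ρ v) (hρ.idem v)).closed
    (P := fun x => τ x = τ v) ?_ rfl
  rintro a b ⟨hab, ha, hb⟩ h
  rcases hτ.edge a b hab with h' | h'
  · have h1 := hτ.fix_of_fix hρ h'.1
    have h2 := hτ.fix_of_fix hρ h'.2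
    exact absurd (h1.symm.trans (Eq.trans ha (Eq.trans (Eq.symm hb) h2))) hab.ne
  · exact h'.symm.trans h

theorem connOn_univ (hρ : g.IsBlockRetraction r ρ) : g.ConnOn Set.univ := by
  refine hρ.block.2.1.extend (Set.subset_univ _) fun v _ => ⟨ρ v, hρ.idem v, ?_⟩
  exact ((hρ.fiber _ (hρ.idem v)).2 v rfl _ (hρ.idem v)).mono (within_mono (Set.subset_univ _))

theorem connOn_compl_root (hρ : g.IsBlockRetraction r ρ) : g.ConnOn {r}ᶜ := by
  refine (hρ.block.2.2 r ((hρ.root r).2 rfl)).extend (fun x hx => hx.2) fun v hv => ?_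
  have hne : ρ v ≠ r := fun h => hv ((hρ.root v).1 h)
  refine ⟨ρ v, ⟨hρ.idem v, hne⟩, ((hρ.fiber _ (hρ.idem v)).2 v rfl _ (hρ.idem v)).mono
    (within_mono ?_)⟩
  rintro x hx rfl
  exact hne (Eq.trans (Eq.symm hx) ((hρ.root x).2 rfl))

/-- A 2-connected set with a vertex moved by `ρ` lies in a single fiber; any other lies in the
block. The fiber of `r` is just `r`, so it is not needed as a piece. -/
theorem mem_iff [Finite V] {𝒢 : GraphClass} (h𝒢 : 𝒢.BlockStable)
    (hρ : g.IsBlockRetraction r ρ) :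
    𝒢.Mem (g.induce Set.univ) ↔ 𝒢.Mem (g.induce {v | ρ v = v}) ∧
      ∀ w, ρ w = w → w ≠ r → 𝒢.Mem (g.induce {v | ρ v = w}) := by
  let A : Option {w // ρ w = w ∧ w ≠ r} → Set V := fun j => j.elim {v | ρ v = v}
    fun w => {v | ρ v = w.1}
  rw [h𝒢.mem_iff_cover (A := A) hρ.connOn_univ]
  · simp [A, Option.forall]
  · rintro (_ | ⟨w, hw⟩)
    · exact hρ.block.2.1
    · exact hρ.fiber w hw.1
  · intro X hX
    by_cases h : ∃ u ∈ X, ρ u ≠ u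
    · obtain ⟨u, hu, hne⟩ := h
      refine ⟨some ⟨ρ u, hρ.idem u, fun h => hne ?_⟩, hρ.subset_fiber hX hu hne⟩
      rw [h, (hρ.root u).1 h]
    · push Not at h
      exact ⟨none, h⟩
  · have key : ∀ w, ({v | ρ v = v} ∩ {v | ρ v = w}).Subsingleton := by
      rintro w x ⟨hx, hx'⟩ y ⟨hy, hy'⟩
      exact (Eq.symm hx).trans (Eq.trans hx' (Eq.trans (Eq.symm hy') hy))
    rintro (_ | ⟨w, hw⟩) (_ | ⟨w', hw'⟩) hjk
    · exact absurd rfl hjk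
    · exact key w'
    · rw [Set.inter_comm]
      exact key w
    · rintro x ⟨hx, hx'⟩ y -
      refine absurd ?_ hjk
      congr 2
      exact Eq.trans (Eq.symm hx) hx'

end IsBlockRetraction

end SimpleGraph

/-! ### Marked graphs: restriction, gluing and transport. -/

/-- A graph together with a second graph (the candidate matching) and a set of vertices (the
candidate independent set) on the same vertices. -/
@[ext]
structure MarkedGraph (V : Type) where
  g : SimpleGraph V
  m : SimpleGraph V
  I : Set V

namespace MarkedGraph

variable {V V' : Type} {J : Type*}

instance [Finite V] : Finite (MarkedGraph V) :=
  Finite.of_injective (fun s => (s.g, s.m, s.I)) fun s t h => by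
    simp only [Prod.mk.injEq] at h
    exact MarkedGraph.ext h.1 h.2.1 h.2.2

noncomputable instance [Finite V] : Fintype (MarkedGraph V) := Fintype.ofFinite _

/-- `s` is a matched graph all of whose edges and marked vertices are in `A`. -/
structure IsMatchedOn (s : MarkedGraph V) (A : Set V) : Prop where
  adj_mem : ∀ u v, s.g.Adj u v → u ∈ A
  le : s.m ≤ s.g
  unique : ∀ u v w, s.m.Adj u v → s.m.Adj u w → v = w
  subset : s.I ⊆ A
  indep : ∀ u v, u ∈ s.I → v ∈ s.I → ¬ s.g.Adj u v
  disj : ∀ u v, u ∈ s.I → ¬ s.m.Adj u v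

/-- The part of `s` inside `A`. -/
def restrict (s : MarkedGraph V) (A : Set V) : MarkedGraph V :=
  ⟨s.g.within A, s.m.within A, s.I ∩ A⟩

/-- The union of a family of marked graphs. -/
def glue (s : J → MarkedGraph V) : MarkedGraph V where
  g := { Adj := fun u v => ∃ j, (s j).g.Adj u v
         symm := ⟨fun _ _ ⟨j, h⟩ => ⟨j, h.symm⟩⟩
         loopless := ⟨fun _ ⟨j, h⟩ => (s j).g.irrefl h⟩ }
  m := { Adj := fun u v => ∃ j, (s j).m.Adj u v
         symm := ⟨fun _ _ ⟨j, h⟩ => ⟨j, h.symm⟩⟩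
         loopless := ⟨fun _ ⟨j, h⟩ => (s j).m.irrefl h⟩ }
  I := {v | ∃ j, v ∈ (s j).I}

open Classical in
/-- The type of a vertex. -/
noncomputable def typ (s : MarkedGraph V) (v : V) : Fin 3 :=
  if v ∈ s.I then 0 else if ∃ w, s.m.Adj v w then 1 else 2

theorem typ_eq_zero {s : MarkedGraph V} {v : V} : s.typ v = 0 ↔ v ∈ s.I := by
  unfold typ
  split_ifs <;> simp_all

theorem IsMatchedOn.typ_eq_one {s : MarkedGraph V} {A : Set V} (hs : s.IsMatchedOn A) {v : V} :
    s.typ v = 1 ↔ ∃ w, s.m.Adj v w := by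
  unfold typ
  split_ifs with h1 h2
  · simpa using fun x => hs.disj v x h1
  · simp [h2]
  · simp [h2]

/-- Types of a vertex in two pieces of a matched graph that can occur together. -/
def CompatTypes (a b : Fin 3) : Prop := (a = 0 ↔ b = 0) ∧ ¬ (a = 1 ∧ b = 1)

instance : DecidableRel CompatTypes := fun _ _ => inferInstanceAs (Decidable (_ ∧ _))

theorem typ_eq_of {s : MarkedGraph V} {t : MarkedGraph V'} {v : V} {w : V'}
    (h0 : v ∈ s.I ↔ w ∈ t.I) (h1 : (∃ x, s.m.Adj v x) ↔ ∃ x, t.m.Adj w x) :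
    s.typ v = t.typ w := by
  classical
  unfold typ
  rw [if_congr h0 rfl (if_congr h1 rfl rfl)]

namespace IsMatchedOn

variable {s : MarkedGraph V} {A B : Set V}

theorem adj_mem' (hs : s.IsMatchedOn A) {u v : V} (h : s.g.Adj u v) : v ∈ A :=
  hs.adj_mem v u h.symm

theorem restrict (hs : s.IsMatchedOn B) (A : Set V) : (s.restrict A).IsMatchedOn A where
  adj_mem _ _ h := h.2.1
  le _ _ h := ⟨hs.le h.1, h.2⟩
  unique u v w h h' := hs.unique u v w h.1 h'.1
  subset _ h := h.2
  indep u v h h' h'' := hs.indep u v h.1 h'.1 h''.1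
  disj u v h h' := hs.disj u v h.1 h'.1

end IsMatchedOn

/-- A family of matched graphs on pieces that agree on the intersections. -/
structure Compatible (A : J → Set V) (s : J → MarkedGraph V) : Prop where
  on : ∀ j, (s j).IsMatchedOn (A j)
  types : ∀ j k v, j ≠ k → v ∈ A j → v ∈ A k → CompatTypes ((s j).typ v) ((s k).typ v)

namespace Compatible

variable {A : J → Set V} {s : J → MarkedGraph V}

theorem mem_I (h : Compatible A s) {j k : J} {v : V} (hj : v ∈ A j) (hv : v ∈ (s k).I) :
    v ∈ (s j).I := by
  by_cases hjk : j = k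
  · exact hjk ▸ hv
  · have := h.types j k v hjk hj ((h.on k).subset hv)
    exact typ_eq_zero.1 (this.1.2 (typ_eq_zero.2 hv))

theorem eq_of_matched (h : Compatible A s) {j k : J} {v a b : V} (hj : (s j).m.Adj v a)
    (hk : (s k).m.Adj v b) : j = k := by
  by_contra hjk
  have := h.types j k v hjk ((h.on j).adj_mem _ _ ((h.on j).le hj))
    ((h.on k).adj_mem _ _ ((h.on k).le hk))
  exact this.2 ⟨(h.on j).typ_eq_one.2 ⟨_, hj⟩, (h.on k).typ_eq_one.2 ⟨_, hk⟩⟩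

theorem glue_isMatchedOn (h : Compatible A s) : (glue s).IsMatchedOn Set.univ where
  adj_mem _ _ _ := trivial
  le := fun _ _ ⟨j, hj⟩ => ⟨j, (h.on j).le hj⟩
  unique := by
    rintro u v w ⟨j, hj⟩ ⟨k, hk⟩
    obtain rfl := h.eq_of_matched hj hk
    exact (h.on j).unique _ _ _ hj hk
  subset := Set.subset_univ _
  indep := by
    rintro u v ⟨j, hj⟩ ⟨k, hk⟩ ⟨l, hl⟩
    exact (h.on l).indep u v (h.mem_I ((h.on l).adj_mem _ _ hl) hj)
      (h.mem_I ((h.on l).adj_mem' hl) hk) hl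
  disj := by
    rintro u v ⟨j, hj⟩ ⟨l, hl⟩
    exact (h.on l).disj u v (h.mem_I ((h.on l).adj_mem _ _ ((h.on l).le hl)) hj) hl

/-- An edge of another piece cannot have both ends in `A j`, since two pieces share at most one
vertex. Independent vertices agree on overlaps by compatibility. -/
theorem restrict_glue (h : Compatible A s) (hsub : ∀ j k, j ≠ k → (A j ∩ A k).Subsingleton)
    (j : J) : (glue s).restrict (A j) = s j := by
  have key : ∀ k u v, (s k).g.Adj u v → u ∈ A j → v ∈ A j → k = j := by
    intro k u v huv hu hv
    by_contra hne
    exact huv.ne (hsub k j hne ⟨(h.on k).adj_mem _ _ huv, hu⟩ ⟨(h.on k).adj_mem' huv, hv⟩)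
  apply MarkedGraph.ext
  · ext u v
    constructor
    · rintro ⟨⟨k, hk⟩, hu, hv⟩
      exact key k u v hk hu hv ▸ hk
    · intro huv
      exact ⟨⟨j, huv⟩, (h.on j).adj_mem _ _ huv, (h.on j).adj_mem' huv⟩
  · ext u v
    constructor
    · rintro ⟨⟨k, hk⟩, hu, hv⟩
      exact key k u v ((h.on k).le hk) hu hv ▸ hk
    · intro huv
      exact ⟨⟨j, huv⟩, (h.on j).adj_mem _ _ ((h.on j).le huv), (h.on j).adj_mem' ((h.on j).le huv)⟩
  · ext v
    constructor
    · rintro ⟨⟨k, hk⟩, hv⟩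
      exact h.mem_I hv hk
    · intro hv
      exact ⟨⟨j, hv⟩, (h.on j).subset hv⟩

theorem typ_glue_of_unique (h : Compatible A s) {j : J} {v : V} (hj : v ∈ A j)
    (hu : ∀ k, v ∈ A k → k = j) : (glue s).typ v = (s j).typ v := by
  refine typ_eq_of ⟨?_, fun hv => ⟨j, hv⟩⟩ ⟨?_, fun ⟨x, hx⟩ => ⟨x, j, hx⟩⟩
  · rintro ⟨k, hk⟩
    exact h.mem_I hj hk
  · rintro ⟨x, k, hk⟩
    obtain rfl := hu k ((h.on k).adj_mem _ _ ((h.on k).le hk))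
    exact ⟨x, hk⟩

/-- The minimum expresses the order of precedence: independence is shared by both pieces, and
otherwise being matched in one of them prevails over being marginal. -/
theorem typ_glue_of_two (h : Compatible A s) {j k : J} {v : V} (hjk : j ≠ k) (hj : v ∈ A j)
    (hk : v ∈ A k) (hu : ∀ l, v ∈ A l → l = j ∨ l = k) :
    (glue s).typ v = min ((s j).typ v) ((s k).typ v) := by
  have hc := h.types j k v hjk hj hk
  have h0 : (glue s).typ v = 0 ↔ (s j).typ v = 0 := by
    rw [typ_eq_zero, typ_eq_zero]
    exact ⟨fun ⟨l, hl⟩ => h.mem_I hj hl, fun hv => ⟨j, hv⟩⟩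
  have h1 : (glue s).typ v = 1 ↔ (s j).typ v = 1 ∨ (s k).typ v = 1 := by
    rw [h.glue_isMatchedOn.typ_eq_one, (h.on j).typ_eq_one, (h.on k).typ_eq_one]
    constructor
    · rintro ⟨x, l, hl⟩
      rcases hu l ((h.on l).adj_mem _ _ ((h.on l).le hl)) with rfl | rfl
      · exact Or.inl ⟨x, hl⟩
      · exact Or.inr ⟨x, hl⟩
    · rintro (⟨x, hx⟩ | ⟨x, hx⟩)
      · exact ⟨x, j, hx⟩
      · exact ⟨x, k, hx⟩
  revert hc h0 h1
  generalize (glue s).typ v = a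
  generalize (s j).typ v = b
  generalize (s k).typ v = c
  revert a b c
  decide

end Compatible

/-- If `v` were matched in two pieces, its unique partner would be a second vertex common to both.
-/
theorem compatible_restrict {s : MarkedGraph V} {A : J → Set V} (hs : s.IsMatchedOn Set.univ)
    (hsub : ∀ j k, j ≠ k → (A j ∩ A k).Subsingleton) :
    Compatible A fun j => s.restrict (A j) where
  on j := hs.restrict (A j)
  types := by
    intro j k v hjk hj hk
    refine ⟨?_, ?_⟩
    · rw [typ_eq_zero, typ_eq_zero]
      exact ⟨fun h => ⟨h.1, hk⟩, fun h => ⟨h.1, hj⟩⟩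
    · rw [(hs.restrict _).typ_eq_one, (hs.restrict _).typ_eq_one]
      rintro ⟨⟨a, ha, -, haj⟩, ⟨b, hb, -, hbk⟩⟩
      obtain rfl := hs.unique _ _ _ ha hb
      exact ha.ne (hsub j k hjk ⟨hj, hk⟩ ⟨haj, hbk⟩)

theorem glue_restrict {s : MarkedGraph V} {A : J → Set V} (hs : s.IsMatchedOn Set.univ)
    (hcov : ∀ v, ∃ j, v ∈ A j) (hedge : ∀ u v, s.g.Adj u v → ∃ j, u ∈ A j ∧ v ∈ A j) :
    glue (fun j => s.restrict (A j)) = s := by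
  apply MarkedGraph.ext
  · ext u v
    constructor
    · rintro ⟨j, h⟩
      exact h.1
    · intro h
      obtain ⟨j, hj⟩ := hedge u v h
      exact ⟨j, h, hj⟩
  · ext u v
    constructor
    · rintro ⟨j, h⟩
      exact h.1
    · intro h
      obtain ⟨j, hj⟩ := hedge u v (hs.le h)
      exact ⟨j, h, hj⟩
  · ext v
    constructor
    · rintro ⟨j, h⟩
      exact h.1
    · intro h
      obtain ⟨j, hj⟩ := hcov v
      exact ⟨j, h, hj⟩

/-- Transport along an embedding of the vertices. -/
def map (f : V ↪ V') (s : MarkedGraph V) : MarkedGraph V' := ⟨s.g.map f, s.m.map f, f '' s.I⟩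

theorem map_injective (f : V ↪ V') : Function.Injective (map f) := by
  intro s t h
  obtain ⟨h1, h2, h3⟩ := MarkedGraph.mk.inj h
  exact MarkedGraph.ext (SimpleGraph.map_injective f h1) (SimpleGraph.map_injective f h2)
    (f.injective.image_injective h3)

theorem typ_map (f : V ↪ V') (s : MarkedGraph V) (v : V) : (s.map f).typ (f v) = s.typ v := by
  refine typ_eq_of ?_ ?_
  · simp [map]
  · constructor
    · rintro ⟨x, -, a, b, hab, ha, rfl⟩
      exact ⟨b, f.injective ha ▸ hab⟩
    · rintro ⟨x, hx⟩
      exact ⟨f x, SimpleGraph.map_adj_apply.2 hx⟩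

theorem IsMatchedOn.map {s : MarkedGraph V} {A : Set V} (f : V ↪ V') (hs : s.IsMatchedOn A) :
    (s.map f).IsMatchedOn (f '' A) where
  adj_mem := by
    rintro _ _ ⟨-, a, b, hab, rfl, rfl⟩
    exact ⟨a, hs.adj_mem _ _ hab, rfl⟩
  le := SimpleGraph.map_monotone f hs.le
  unique := by
    rintro _ _ _ ⟨-, a, b, hab, rfl, rfl⟩ ⟨-, a', b', hab', h, rfl⟩
    obtain rfl := f.injective h
    rw [hs.unique _ _ _ hab hab']
  subset := Set.image_mono hs.subset
  indep := by
    rintro _ _ ⟨a, ha, rfl⟩ ⟨b, hb, rfl⟩ h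
    exact hs.indep a b ha hb (SimpleGraph.map_adj_apply.1 h)
  disj := by
    rintro _ _ ⟨a, ha, rfl⟩ ⟨-, a', b, hab, h, rfl⟩
    obtain rfl := f.injective h
    exact hs.disj _ b ha hab

/-- All edges and marks of `t` lie in the range of `f`, so nothing is lost by pulling back. -/
theorem IsMatchedOn.exists_map {A : Set V} (f : V ↪ V') {t : MarkedGraph V'}
    (ht : t.IsMatchedOn (f '' A)) : ∃ s : MarkedGraph V, s.IsMatchedOn A ∧ s.map f = t := by
  refine ⟨⟨t.g.comap f, t.m.comap f, f ⁻¹' t.I⟩, ⟨?_, ?_, ?_, ?_, ?_, ?_⟩, ?_⟩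
  · intro u v h
    exact f.injective.mem_set_image.1 (ht.adj_mem _ _ h)
  · intro u v h
    exact ht.le h
  · intro u v w h h'
    exact f.injective (ht.unique _ _ _ h h')
  · intro v hv
    exact f.injective.mem_set_image.1 (ht.subset hv)
  · intro u v hu hv
    exact ht.indep _ _ hu hv
  · intro u v hu
    exact ht.disj _ _ hu
  · apply MarkedGraph.ext
    · ext u v
      constructor
      · rintro ⟨-, a, b, hab, rfl, rfl⟩
        exact hab
      · intro h
        obtain ⟨a, -, rfl⟩ := ht.adj_mem _ _ h
        obtain ⟨b, -, rfl⟩ := ht.adj_mem' h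
        exact SimpleGraph.map_adj_apply.2 h
    · ext u v
      constructor
      · rintro ⟨-, a, b, hab, rfl, rfl⟩
        exact hab
      · intro h
        obtain ⟨a, -, rfl⟩ := ht.adj_mem _ _ (ht.le h)
        obtain ⟨b, -, rfl⟩ := ht.adj_mem' (ht.le h)
        exact SimpleGraph.map_adj_apply.2 h
    · ext v
      constructor
      · rintro ⟨a, ha, rfl⟩
        exact ha
      · intro h
        obtain ⟨a, -, rfl⟩ := ht.subset h
        exact ⟨a, h, rfl⟩

/-! ### Weighted counts of rooted matched graphs. -/

open Classical in
/-- The weighted number of the matched graphs on `A` whose graph satisfies `P` and in which `r` has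
type `i`; a vertex of type `j` other than `r` has weight `z j`. -/
noncomputable def rootedSum {R : Type*} [CommRing R] [Finite V] [DecidableEq V]
    (P : SimpleGraph V → Prop)
    (i : Fin 3) (z : Fin 3 → R) (A : Finset V) (r : V) : R :=
  ∑ s : MarkedGraph V with s.IsMatchedOn A ∧ P s.g ∧ s.typ r = i, ∏ v ∈ A.erase r, z (s.typ v)

theorem rootedSum_map {R : Type*} [CommRing R] [Finite V] [Finite V'] [DecidableEq V]
    [DecidableEq V'] (f : V ↪ V')
    {P : SimpleGraph V → Prop} {P' : SimpleGraph V' → Prop} (hP : ∀ g, P' (g.map f) ↔ P g)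
    (i : Fin 3) (z : Fin 3 → R) (A : Finset V) (r : V) :
    rootedSum P' i z (A.map f) (f r) = rootedSum P i z A r := by
  classical
  unfold rootedSum
  symm
  refine Finset.sum_bij (fun s _ => s.map f) ?_ ?_ ?_ ?_
  · intro s hs
    simp only [Finset.mem_filter, Finset.mem_univ, true_and] at hs ⊢
    refine ⟨?_, (hP _).2 hs.2.1, (typ_map f s r).trans hs.2.2⟩
    rw [Finset.coe_map]
    exact hs.1.map f
  · intro s _ t _ h
    exact map_injective f h
  · intro t ht
    simp only [Finset.mem_filter, Finset.mem_univ, true_and, Finset.coe_map] at ht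
    obtain ⟨s, hs, rfl⟩ := ht.1.exists_map f
    refine ⟨s, ?_, rfl⟩
    simp only [Finset.mem_filter, Finset.mem_univ, true_and]
    exact ⟨hs, (hP _).1 ht.2.1, (typ_map f s r).symm.trans ht.2.2⟩
  · intro s _
    rw [← Finset.map_erase, Finset.prod_map]
    simp only [typ_map]

end MarkedGraph

section

open MarkedGraph

/-- A property of rooted graphs on the vertex set `A` that is stable under isomorphism. -/
structure RootedProp where
  holds : ∀ {V : Type}, Set V → V → SimpleGraph V → Prop
  map_iff : ∀ {V V' : Type} (f : V ↪ V') (A : Set V) (r : V) (g : SimpleGraph V),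
    holds (f '' A) (f r) (g.map f) ↔ holds A r g

namespace RootedProp

variable {R : Type*} [CommRing R]

/-- The weighted number of matched graphs on `A` rooted at `r` with the property `Q`. -/
noncomputable def sum (Q : RootedProp) {V : Type} [Finite V] [DecidableEq V] (i : Fin 3)
    (z : Fin 3 → R)
    (A : Finset V) (r : V) : R :=
  rootedSum (Q.holds A r) i z A r

/-- The weighted number of matched graphs with `n` vertices besides the root. -/
noncomputable def seq (Q : RootedProp) (i : Fin 3) (z : Fin 3 → R) (n : ℕ) : R :=
  Q.sum i z (Finset.univ : Finset (Fin (n + 1))) (Fin.last n)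

theorem sum_map (Q : RootedProp) {V V' : Type} [Finite V] [Finite V'] [DecidableEq V]
    [DecidableEq V'] (f : V ↪ V') (i : Fin 3) (z : Fin 3 → R) (A : Finset V) (r : V) :
    Q.sum i z (A.map f) (f r) = Q.sum i z A r := by
  unfold sum
  rw [Finset.coe_map]
  exact rootedSum_map f (fun g => Q.map_iff f A r g) i z A r

/-- The count depends only on the number of vertices. Any labelling of `A`, composed with a
transposition that gives the root the last label, reduces it to the standard one. -/
theorem sum_eq_seq (Q : RootedProp) {V : Type} [Finite V] [DecidableEq V] (i : Fin 3)
    (z : Fin 3 → R) {A : Finset V} {r : V} (hr : r ∈ A) :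
    Q.sum i z A r = Q.seq i z (A.erase r).card := by
  classical
  obtain ⟨n, hn⟩ : ∃ n, n = (A.erase r).card := ⟨_, rfl⟩
  have hA : A.card = n + 1 := by rw [hn, Finset.card_erase_add_one hr]
  let e₀ : Fin (n + 1) ≃ A := (Finset.equivFinOfCardEq hA).symm
  let e : Fin (n + 1) ≃ A := (Equiv.swap (Fin.last n) (e₀.symm ⟨r, hr⟩)).trans e₀
  let f : Fin (n + 1) ↪ V := e.toEmbedding.trans (Function.Embedding.subtype _)
  have hf : f (Fin.last n) = r := by
    simp [f, e]
  have hAf : Finset.univ.map f = A := by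
    ext x
    simp only [Finset.mem_map, Finset.mem_univ, true_and]
    constructor
    · rintro ⟨y, rfl⟩
      exact (e y).2
    · intro hx
      refine ⟨e.symm ⟨x, hx⟩, ?_⟩
      change ((e (e.symm ⟨x, hx⟩) : A) : V) = x
      simp
  rw [← hn, seq, ← Q.sum_map f, hf, hAf]

end RootedProp

namespace GraphClass

variable (𝒢 : GraphClass)

theorem mem_map_iff {V V' : Type} (f : V ↪ V') (A : Set V) (g : SimpleGraph V) :
    𝒢.Mem ((g.map f).induce (f '' A)) ↔ 𝒢.Mem (g.induce A) :=
  (mem_congr (SimpleGraph.induceImageIso (SimpleGraph.Embedding.map f g) A)).symm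

/-- Connected graphs of the class. -/
def conn : RootedProp where
  holds A _ g := g.ConnOn A ∧ 𝒢.Mem (g.induce A)
  map_iff f A _ g := and_congr (SimpleGraph.connOn_image (SimpleGraph.Embedding.map f g))
    (𝒢.mem_map_iff f A g)

/-- 2-connected graphs of the class. -/
def block : RootedProp where
  holds A _ g := g.TwoConnOn A ∧ 𝒢.Mem (g.induce A)
  map_iff f A _ g := and_congr (SimpleGraph.twoConnOn_image (SimpleGraph.Embedding.map f g))
    (𝒢.mem_map_iff f A g)

/-- Connected graphs of the class that stay connected when the root is removed. -/
def branch : RootedProp where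
  holds A r g := (g.ConnOn A ∧ g.ConnOn (A \ {r})) ∧ 𝒢.Mem (g.induce A)
  map_iff f A r g := by
    rw [𝒢.mem_map_iff f A g, ← Set.image_singleton, ← Set.image_sdiff f.injective]
    exact and_congr (and_congr (SimpleGraph.connOn_image (SimpleGraph.Embedding.map f g))
      (SimpleGraph.connOn_image (SimpleGraph.Embedding.map f g))) Iff.rfl

end GraphClass

/-! ### Splitting off a branch at the root. -/

namespace MarkedGraph

variable {V : Type}

/-- The two pieces of a graph with the branch `A` at `r`. -/
def branchPieces (r : V) (A : Set V) : Bool → Set V := fun b => cond b (insert r A) Aᶜ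

theorem branchPieces_subsingleton (r : V) (A : Set V) (j k : Bool) (hjk : j ≠ k) :
    (branchPieces r A j ∩ branchPieces r A k).Subsingleton := by
  have key : ∀ x, x ∈ insert r A → x ∈ Aᶜ → x = r := fun x hx hx' => hx.resolve_right hx'
  rintro x ⟨hx, hx'⟩ y ⟨hy, hy'⟩
  cases j <;> cases k
  · exact absurd rfl hjk
  · exact (key x hx' hx).trans (key y hy' hy).symm
  · exact (key x hx hx').trans (key y hy hy').symm
  · exact absurd rfl hjk

theorem glue_branchPieces {s : MarkedGraph V} {r : V} {A : Set V}
    (hs : s.IsMatchedOn Set.univ) (hA : s.g.IsBranch r A) :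
    glue (fun b => s.restrict (branchPieces r A b)) = s := by
  have edge : ∀ u v, s.g.Adj u v → u ∈ A → v ∈ insert r A := fun u v huv hu => by
    by_cases hv : v = r
    · exact Or.inl hv
    · exact Or.inr (hA.edge u v huv hu hv)
  refine glue_restrict hs (fun v => ?_) fun u v huv => ?_
  · by_cases hv : v ∈ A
    · exact ⟨true, Or.inr hv⟩
    · exact ⟨false, hv⟩
  · by_cases hu : u ∈ A
    · exact ⟨true, Or.inr hu, edge u v huv hu⟩
    by_cases hv : v ∈ A
    · exact ⟨true, edge v u huv.symm hv, Or.inr hv⟩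
    · exact ⟨false, hu, hv⟩

theorem Compatible.typ_glue_branchPieces {r : V} {A : Set V} (hr : r ∉ A)
    {s : Bool → MarkedGraph V} (hs : Compatible (branchPieces r A) s) :
    (glue s).typ r = min ((s true).typ r) ((s false).typ r) :=
  hs.typ_glue_of_two (by simp) (Or.inl rfl) hr (by rintro (_ | _) _ <;> simp)

theorem typ_root_of_isBranch {s : MarkedGraph V} {r : V} {A : Set V}
    (hs : s.IsMatchedOn Set.univ) (hA : s.g.IsBranch r A) :
    s.typ r = min ((s.restrict (insert r A)).typ r) ((s.restrict Aᶜ).typ r) ∧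
      CompatTypes ((s.restrict (insert r A)).typ r) ((s.restrict Aᶜ).typ r) := by
  have hc := compatible_restrict hs (branchPieces_subsingleton r A)
  refine ⟨?_, hc.types true false r (by simp) (Or.inl rfl) hA.root⟩
  conv_lhs => rw [← glue_branchPieces hs hA]
  exact hc.typ_glue_branchPieces hA.root

variable {R : Type*} [CommRing R]

open Classical in
/-- The matched graphs with the branch `A` at `r`, where `r` has type `i` in the branch and type `j`
in the rest. -/
noncomputable def branchSet [Finite V] (𝒢 : GraphClass) (r : V) (A : Finset V) (i j : Fin 3) :
    Finset (MarkedGraph V) :=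
  {s | s.IsMatchedOn Set.univ ∧ s.g.IsBranch r A ∧ 𝒢.Mem (s.g.induce Set.univ) ∧
      (s.restrict (insert r A)).typ r = i ∧ (s.restrict (A : Set V)ᶜ).typ r = j}

theorem mem_branchSet [Finite V] {𝒢 : GraphClass} {r : V} {A : Finset V} {i j : Fin 3}
    {s : MarkedGraph V} : s ∈ branchSet 𝒢 r A i j ↔
      s.IsMatchedOn Set.univ ∧ s.g.IsBranch r A ∧ 𝒢.Mem (s.g.induce Set.univ) ∧
      (s.restrict (insert r A)).typ r = i ∧ (s.restrict (A : Set V)ᶜ).typ r = j := by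
  classical
  simp [branchSet]

/-- Restricting to the two pieces and gluing them at `r` are inverse to each other, and the weight
is multiplicative because the root carries none. -/
theorem sum_branchSet [Fintype V] [DecidableEq V] {𝒢 : GraphClass} (h𝒢 : 𝒢.BlockStable) {r : V}
    {A : Finset V} (hr : r ∉ A) {i j : Fin 3} (hij : CompatTypes i j) (z : Fin 3 → R) :
    ∑ s ∈ branchSet 𝒢 r A i j, ∏ v ∈ Finset.univ.erase r, z (s.typ v) =
      𝒢.branch.sum i z (insert r A) r * 𝒢.conn.sum j z Aᶜ r := by
  classical
  unfold RootedProp.sum rootedSum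
  rw [Finset.sum_mul_sum, ← Finset.sum_product']
  have hsub := branchPieces_subsingleton r (A : Set V)
  have hins : ((insert r A : Finset V) : Set V) = insert r (A : Set V) := Finset.coe_insert _ _
  have hcom : ((Aᶜ : Finset V) : Set V) = (A : Set V)ᶜ := Finset.coe_compl _
  have hdiff : insert r (A : Set V) \ {r} = A := by
    simp [hr]
  simp only [hins, hcom, GraphClass.branch, GraphClass.conn]
  -- The pieces meet only in `r`, so the types `i` and `j` there are all that has to fit.
  have hcomp : ∀ a c : MarkedGraph V, a.IsMatchedOn (insert r (A : Set V)) →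
      c.IsMatchedOn (A : Set V)ᶜ → a.typ r = i → c.typ r = j →
      Compatible (branchPieces r A) fun b => cond b a c := by
    intro a c ha hc hai hcj
    refine ⟨by rintro (_ | _); exacts [hc, ha], ?_⟩
    intro j' k v hjk hj hk
    obtain rfl : v = r := by
      refine hsub j' k hjk ⟨hj, hk⟩ ?_
      cases j' <;> cases k <;> simp_all [branchPieces]
    cases j' <;> cases k
    · exact absurd rfl hjk
    · change CompatTypes (c.typ v) (a.typ v)
      rw [hai, hcj]
      exact ⟨hij.1.symm, fun h => hij.2 ⟨h.2, h.1⟩⟩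
    · change CompatTypes (a.typ v) (c.typ v)
      rw [hai, hcj]
      exact hij
    · exact absurd rfl hjk
  refine Finset.sum_bij' (fun s _ => (s.restrict (insert r (A : Set V)), s.restrict (A : Set V)ᶜ))
    (fun p _ => glue fun b => cond b p.1 p.2) ?_ ?_ ?_ ?_ ?_
  · intro s hs
    obtain ⟨h1, h2, h3, h4, h5⟩ := mem_branchSet.1 hs
    have hm := (h2.mem_iff h𝒢).1 h3
    simp only [Finset.mem_product, Finset.mem_filter, Finset.mem_univ, true_and]
    refine ⟨⟨h1.restrict _, ⟨⟨?_, ?_⟩, ?_⟩, h4⟩, h1.restrict _, ⟨?_, ?_⟩, h5⟩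
    · exact (SimpleGraph.ConnOn.congr (SimpleGraph.induce_within _ le_rfl)).2 h2.conn_insert
    · rw [hdiff]
      exact (SimpleGraph.ConnOn.congr
        (SimpleGraph.induce_within _ (Set.subset_insert _ _))).2 h2.conn
    · change 𝒢.Mem ((s.g.within _).induce _)
      rw [SimpleGraph.induce_within _ le_rfl]
      exact hm.1
    · exact (SimpleGraph.ConnOn.congr (SimpleGraph.induce_within _ le_rfl)).2 h2.conn_compl
    · change 𝒢.Mem ((s.g.within _).induce _)
      rw [SimpleGraph.induce_within _ le_rfl]
      exact hm.2
  · rintro ⟨a, c⟩ h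
    simp only [Finset.mem_product, Finset.mem_filter, Finset.mem_univ, true_and] at h
    obtain ⟨⟨ha, ⟨⟨ha1, ha2⟩, ha3⟩, hai⟩, hc, ⟨hc1, hc2⟩, hcj⟩ := h
    rw [hdiff] at ha2
    have hC := hcomp a c ha hc hai hcj
    have ea : (glue fun b => cond b a c).restrict (insert r (A : Set V)) = a :=
      hC.restrict_glue hsub true
    have ec : (glue fun b => cond b a c).restrict (A : Set V)ᶜ = c :=
      hC.restrict_glue hsub false
    set s := glue fun b => cond b a c
    have ga : a.g.induce (insert r (A : Set V)) = s.g.induce (insert r (A : Set V)) := by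
      rw [← ea]
      exact SimpleGraph.induce_within _ le_rfl
    have ga' : a.g.induce (A : Set V) = s.g.induce (A : Set V) := by
      rw [← ea]
      exact SimpleGraph.induce_within _ (Set.subset_insert _ _)
    have gc : c.g.induce (A : Set V)ᶜ = s.g.induce (A : Set V)ᶜ := by
      rw [← ec]
      exact SimpleGraph.induce_within _ le_rfl
    have hB : s.g.IsBranch r A := by
      refine ⟨hr, ?_, (SimpleGraph.ConnOn.congr ga').1 ha2, (SimpleGraph.ConnOn.congr ga).1 ha1,
        (SimpleGraph.ConnOn.congr gc).1 hc1⟩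
      rintro u v ⟨(_ | _), h⟩ hu hv
      · exact absurd hu (hc.adj_mem u v h)
      · exact (ha.adj_mem' h).resolve_left hv
    rw [mem_branchSet]
    refine ⟨hC.glue_isMatchedOn, hB, (hB.mem_iff h𝒢).2 ⟨?_, ?_⟩, ?_, ?_⟩
    · rw [← ga]
      exact ha3
    · rw [← gc]
      exact hc2
    · rw [ea, hai]
    · rw [ec, hcj]
  · intro s hs
    obtain ⟨h1, h2, -⟩ := mem_branchSet.1 hs
    refine Eq.trans ?_ (glue_branchPieces h1 h2)
    congr 1
    funext b
    cases b <;> rfl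
  · rintro ⟨a, c⟩ h
    simp only [Finset.mem_product, Finset.mem_filter, Finset.mem_univ, true_and] at h
    obtain ⟨⟨ha, -, hai⟩, hc, -, hcj⟩ := h
    have hC := hcomp a c ha hc hai hcj
    exact Prod.ext (hC.restrict_glue hsub true) (hC.restrict_glue hsub false)
  · intro s hs
    obtain ⟨h1, h2, h3, h4, h5⟩ := mem_branchSet.1 hs
    have hc := compatible_restrict h1 hsub
    have e : Finset.univ.erase r = A ∪ (Aᶜ).erase r := by
      ext v
      simp only [Finset.mem_erase, Finset.mem_univ, and_true, Finset.mem_union, Finset.mem_compl]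
      constructor
      · intro hv
        by_cases hvA : v ∈ A
        · exact Or.inl hvA
        · exact Or.inr ⟨hv, hvA⟩
      · rintro (hv | hv)
        · rintro rfl
          exact hr hv
        · exact hv.1
    have hd : Disjoint A (Aᶜ.erase r) :=
      Finset.disjoint_left.2 fun v hv hv' => by simp [hv] at hv'
    -- Every vertex other than `r` lies in exactly one piece, where it has the same type as in the
    -- whole.
    rw [e, Finset.prod_union hd, Finset.erase_insert hr]
    congr 1
    · refine Finset.prod_congr rfl fun v hv => ?_
      conv_lhs => rw [← glue_branchPieces h1 h2]
      rw [hc.typ_glue_of_unique (j := true) (Or.inr hv) ?_]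
      · rfl
      · rintro (_ | _) h
        · exact absurd hv h
        · rfl
    · refine Finset.prod_congr rfl fun v hv => ?_
      rw [Finset.mem_erase, Finset.mem_compl] at hv
      conv_lhs => rw [← glue_branchPieces h1 h2]
      rw [hc.typ_glue_of_unique (j := false) (by exact hv.2) ?_]
      · rfl
      · rintro (_ | _) h
        · rfl
        · exact absurd (h.resolve_left hv.1) hv.2

/-- The common frame of both splitting rules: `hex` and `huniq` say that each graph in question
selects exactly one branch from `𝒜`, with the prescribed types of the root. -/
theorem conn_sum_eq_sum_branch [Fintype V] [DecidableEq V] {𝒢 : GraphClass}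
    (h𝒢 : 𝒢.BlockStable) {r : V} {i j : Fin 3} (hij : CompatTypes i j) (z : Fin 3 → R)
    (𝒜 : Finset (Finset V)) (h𝒜 : ∀ A ∈ 𝒜, r ∉ A)
    (hex : ∀ s : MarkedGraph V, s.IsMatchedOn Set.univ → s.g.ConnOn Set.univ →
      s.typ r = min i j → ∃ A ∈ 𝒜, s.g.IsBranch r A ∧
        (s.restrict (insert r A)).typ r = i ∧ (s.restrict (A : Set V)ᶜ).typ r = j)
    (huniq : ∀ A ∈ 𝒜, ∀ B ∈ 𝒜, ∀ s, s ∈ branchSet 𝒢 r A i j → s ∈ branchSet 𝒢 r B i j → A = B) :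
    𝒢.conn.sum (min i j) z Finset.univ r =
      ∑ A ∈ 𝒜, 𝒢.branch.sum i z (insert r A) r * 𝒢.conn.sum j z Aᶜ r := by
  classical
  rw [Finset.sum_congr rfl fun A hA => (sum_branchSet h𝒢 (h𝒜 A hA) hij z).symm,
    ← Finset.sum_biUnion]
  · unfold RootedProp.sum rootedSum
    refine Finset.sum_congr ?_ fun _ _ => rfl
    ext s
    simp only [Finset.mem_filter, Finset.mem_univ, true_and, Finset.mem_biUnion, mem_branchSet,
      Finset.coe_univ, GraphClass.conn]
    constructor
    · rintro ⟨h1, ⟨h2, h3⟩, h4⟩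
      obtain ⟨A, hA, h5, h6, h7⟩ := hex s h1 h2 h4
      exact ⟨A, hA, h1, h5, h3, h6, h7⟩
    · rintro ⟨A, hA, h1, h2, h3, h4, h5⟩
      exact ⟨h1, ⟨h2.connOn_univ, h3⟩, by rw [(typ_root_of_isBranch h1 h2).1, h4, h5]⟩
  · intro A hA B hB hne
    exact Finset.disjoint_left.2 fun s hs hs' => hne (huniq A hA B hB s hs hs')

/-- Split off the branch that contains the vertex `u`. -/
theorem conn_sum_eq_of_ne_one [Fintype V] [DecidableEq V] {𝒢 : GraphClass}
    (h𝒢 : 𝒢.BlockStable) {r u : V} (hur : u ≠ r) {i : Fin 3} (hi : i ≠ 1) (z : Fin 3 → R) :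
    𝒢.conn.sum i z Finset.univ r = ∑ A : Finset V with u ∈ A ∧ r ∉ A,
      𝒢.branch.sum i z (insert r A) r * 𝒢.conn.sum i z Aᶜ r := by
  classical
  have := conn_sum_eq_sum_branch h𝒢 (r := r) (i := i) (j := i) ⟨Iff.rfl, fun h => hi h.1⟩ z
    {A : Finset V | u ∈ A ∧ r ∉ A} ?_ ?_ ?_
  · rwa [min_self] at this
  · intro A hA
    exact (Finset.mem_filter.1 hA).2.2
  · intro s hs hc ht
    obtain ⟨A, huA, hA⟩ := SimpleGraph.exists_isBranch hc hur
    refine ⟨A.toFinset, ?_, ?_⟩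
    · simpa using ⟨huA, hA.root⟩
    · rw [Set.coe_toFinset]
      obtain ⟨h1, h2⟩ := typ_root_of_isBranch hs hA
      refine ⟨hA, ?_⟩
      rw [ht, min_self] at h1
      clear ht
      -- For compatible types with minimum 0 or 2, both types equal the minimum.
      revert hi h1 h2
      generalize (s.restrict (insert r A)).typ r = a
      generalize (s.restrict Aᶜ).typ r = b
      revert i a b
      decide
  · intro A hA B hB s hs hs'
    have := (mem_branchSet.1 hs).2.1.eq_of_mem (mem_branchSet.1 hs').2.1
      (Finset.mem_filter.1 hA).2.1 (Finset.mem_filter.1 hB).2.1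
    exact Finset.coe_injective this

/-- Split off the branch that contains the partner of the root in the matching. -/
theorem conn_sum_one [Fintype V] [DecidableEq V] {𝒢 : GraphClass}
    (h𝒢 : 𝒢.BlockStable) (r : V) (z : Fin 3 → R) :
    𝒢.conn.sum 1 z Finset.univ r = ∑ A : Finset V with r ∉ A,
      𝒢.branch.sum 1 z (insert r A) r * 𝒢.conn.sum 2 z Aᶜ r := by
  classical
  refine conn_sum_eq_sum_branch h𝒢 (r := r) (i := 1) (j := 2) (by decide) z
    {A : Finset V | r ∉ A} ?_ ?_ ?_
  · intro A hA
    exact (Finset.mem_filter.1 hA).2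
  · intro s hs hc ht
    obtain ⟨u, hu⟩ := hs.typ_eq_one.1 ht
    obtain ⟨A, huA, hA⟩ := SimpleGraph.exists_isBranch hc hu.ne'
    refine ⟨A.toFinset, ?_, ?_⟩
    · simpa using hA.root
    · rw [Set.coe_toFinset]
      obtain ⟨-, h2⟩ := typ_root_of_isBranch hs hA
      have h3 : (s.restrict (insert r A)).typ r = 1 :=
        (hs.restrict _).typ_eq_one.2 ⟨u, hu, Or.inl rfl, Or.inr huA⟩
      refine ⟨hA, h3, ?_⟩
      rw [h3] at h2
      revert h2
      generalize (s.restrict Aᶜ).typ r = b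
      revert b
      decide
  · intro A hA B hB s hs hs'
    obtain ⟨h1, h2, -, h4, -⟩ := mem_branchSet.1 hs
    obtain ⟨-, h2', -, h4', -⟩ := mem_branchSet.1 hs'
    obtain ⟨u, hu, -, huA⟩ := (h1.restrict _).typ_eq_one.1 h4
    obtain ⟨v, hv, -, hvB⟩ := (h1.restrict _).typ_eq_one.1 h4'
    obtain rfl := h1.unique _ _ _ hu hv
    exact Finset.coe_injective
      (h2.eq_of_mem h2' (huA.resolve_left hu.ne') (hvB.resolve_left hu.ne'))

end MarkedGraph

/-! ### Decomposition along the block at the root. -/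

namespace MarkedGraph

variable {V : Type} {R : Type*} [CommRing R]

/-- The pieces of a graph with the block retraction `ρ`: the block, and the graphs attached to the
vertices in `S`. -/
def retractionPieces (ρ : V → V) (S : Finset V) : Option S → Set V :=
  fun o => o.elim {v | ρ v = v} fun w => {v | ρ v = w}

theorem retractionPieces_subsingleton (ρ : V → V) (S : Finset V) (j k : Option S) (hjk : j ≠ k) :
    (retractionPieces ρ S j ∩ retractionPieces ρ S k).Subsingleton := by
  have key : ∀ w, ({v | ρ v = v} ∩ {v | ρ v = w}).Subsingleton := by
    rintro w x ⟨hx, hx'⟩ y ⟨hy, hy'⟩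
    exact (Eq.symm hx).trans (Eq.trans hx' (Eq.trans (Eq.symm hy') hy))
  rcases j with (_ | w) <;> rcases k with (_ | w')
  · exact absurd rfl hjk
  · exact key w'
  · rw [Set.inter_comm]
    exact key w
  · rintro x ⟨hx, hx'⟩ y -
    refine absurd ?_ hjk
    congr 1
    exact Subtype.ext (Eq.trans (Eq.symm hx) hx')

/-- The weight of a vertex that has type `a` in the block and type `b` in the attached graph. -/
def joinWeight (z : Fin 3 → R) (a b : Fin 3) : R := if CompatTypes a b then z (min a b) else 0

/-- Merges the sum over the type of the attached root into a sum over graphs, the form needed to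
expand a product of such sums over the block vertices. -/
theorem sum_mul_sum_eq [Finite V] [DecidableEq V] (Q : RootedProp) (f z : Fin 3 → R)
    (T : Finset V) (w : V) :
    ∑ t, f t * Q.sum t z T w =
      open Classical in
      ∑ h : MarkedGraph V with h.IsMatchedOn T ∧ Q.holds T w h.g,
        f (h.typ w) * ∏ v ∈ T.erase w, z (h.typ v) := by
  classical
  rw [← Finset.sum_fiberwise _ (fun h : MarkedGraph V => h.typ w)]
  refine Finset.sum_congr rfl fun t _ => ?_
  unfold RootedProp.sum rootedSum
  rw [Finset.mul_sum, Finset.filter_filter]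
  refine Finset.sum_congr ?_ fun h hh => ?_
  · ext h
    simp [and_assoc]
  · rw [(Finset.mem_filter.1 hh).2.2]

open Classical in
/-- The matched graphs of the class with block retraction `ρ` in which the root has type `i`. -/
noncomputable def retractionSet [Finite V] (𝒢 : GraphClass) (r : V) (ρ : V → V) (i : Fin 3) :
    Finset (MarkedGraph V) :=
  {s | s.IsMatchedOn Set.univ ∧ s.g.IsBlockRetraction r ρ ∧ 𝒢.Mem (s.g.induce Set.univ) ∧
      s.typ r = i}

theorem mem_retractionSet [Finite V] {𝒢 : GraphClass} {r : V} {ρ : V → V} {i : Fin 3}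
    {s : MarkedGraph V} : s ∈ retractionSet 𝒢 r ρ i ↔
      s.IsMatchedOn Set.univ ∧ s.g.IsBlockRetraction r ρ ∧ 𝒢.Mem (s.g.induce Set.univ) ∧
      s.typ r = i := by
  classical
  simp [retractionSet]

theorem glue_retractionPieces {s : MarkedGraph V} {r : V} {ρ : V → V} {S : Finset V}
    (hS : ∀ w, w ∈ S ↔ w ≠ r ∧ ρ w = w)
    (hs : s.IsMatchedOn Set.univ) (hρ : s.g.IsBlockRetraction r ρ) :
    glue (fun o => s.restrict (retractionPieces ρ S o)) = s := by
  have key : ∀ v, ρ v ≠ v → ρ v ∈ S := fun v hv => by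
    refine (hS _).2 ⟨fun h => hv ?_, hρ.idem v⟩
    rw [h, (hρ.root v).1 h]
  refine glue_restrict hs (fun v => ?_) fun u v huv => ?_
  · by_cases hv : ρ v = v
    · exact ⟨none, hv⟩
    · exact ⟨some ⟨_, key v hv⟩, rfl⟩
  · rcases hρ.edge u v huv with h | h
    · exact ⟨none, h⟩
    · by_cases hu : ρ u = u
      · have hv : ρ v ≠ v := fun hv => huv.ne (hu.symm.trans (h.trans hv))
        exact ⟨some ⟨_, key v hv⟩, h, rfl⟩
      · exact ⟨some ⟨_, key u hu⟩, rfl, h.symm⟩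

/-- A graph with retraction `ρ` is the same as its block together with one connected graph on each
fiber over a block vertex other than the root. Expanding the product of sums makes a choice of such
a family a single term. -/
theorem sum_retractionSet [Fintype V] [DecidableEq V] {𝒢 : GraphClass} (h𝒢 : 𝒢.BlockStable)
    {r : V} {ρ : V → V} (hidem : ∀ v, ρ (ρ v) = ρ v) (hroot : ∀ v, ρ v = r ↔ v = r) (i : Fin 3)
    (z : Fin 3 → R) (F : Finset V) (hF : ∀ v, v ∈ F ↔ ρ v = v) :
    ∑ s ∈ retractionSet 𝒢 r ρ i, ∏ v ∈ Finset.univ.erase r, z (s.typ v) =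
      open Classical in
      ∑ β : MarkedGraph V with β.IsMatchedOn F ∧ 𝒢.block.holds F r β.g ∧ β.typ r = i,
        ∏ w ∈ F.erase r,
          ∑ t, joinWeight z (β.typ w) t * 𝒢.conn.sum t z {v | ρ v = w} w := by
  classical
  have hFc : (F : Set V) = {v | ρ v = v} := Set.ext hF
  have hT : ∀ w : V, ((Finset.univ.filter fun v => ρ v = w : Finset V) : Set V) = {v | ρ v = w} :=
    fun w => by ext; simp
  obtain ⟨S, hSdef⟩ : ∃ S, S = F.erase r := ⟨_, rfl⟩
  have hS : ∀ w, w ∈ S ↔ w ≠ r ∧ ρ w = w := fun w => by rw [hSdef, Finset.mem_erase, hF]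
  have hmapS : ∀ v, v ≠ r → ρ v ∈ S := fun v hv =>
    (hS _).2 ⟨fun h => hv ((hroot v).1 h), hidem v⟩
  simp only [sum_mul_sum_eq, hT, hFc, ← hSdef]
  have hsub := retractionPieces_subsingleton ρ S
  set D : S → Finset (MarkedGraph V) := fun w =>
    {h | h.IsMatchedOn {v | ρ v = w} ∧ 𝒢.conn.holds {v | ρ v = w} w h.g} with hD
  have hmemD : ∀ (w : S) h, h ∈ D w ↔
      h.IsMatchedOn {v | ρ v = w} ∧ 𝒢.conn.holds {v | ρ v = w} w.1 h.g := fun w h => by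
    simp [hD]
  set B : Finset (MarkedGraph V) :=
    {β | β.IsMatchedOn {v | ρ v = v} ∧ 𝒢.block.holds {v | ρ v = v} r β.g ∧ β.typ r = i} with hB
  have hmemB : ∀ β, β ∈ B ↔
      β.IsMatchedOn {v | ρ v = v} ∧ 𝒢.block.holds {v | ρ v = v} r β.g ∧ β.typ r = i := fun β => by
    simp [hB]
  have expand : ∀ β : MarkedGraph V,
      ∏ w ∈ S, ∑ h : MarkedGraph V with h.IsMatchedOn {v | ρ v = w} ∧
          𝒢.conn.holds {v | ρ v = w} w h.g,
        joinWeight z (β.typ w) (h.typ w) *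
          ∏ v ∈ (Finset.univ.filter fun v => ρ v = w).erase w, z (h.typ v) =
      ∑ h ∈ Fintype.piFinset D, ∏ w : S, joinWeight z (β.typ w) ((h w).typ w) *
          ∏ v ∈ (Finset.univ.filter fun v => ρ v = w).erase w.1, z ((h w).typ v) := by
    intro β
    rw [← Finset.prod_coe_sort]
    exact Finset.prod_univ_sum (R := R) D fun w h => joinWeight z (β.typ w) (h.typ w) *
      ∏ v ∈ (Finset.univ.filter fun v => ρ v = w).erase w.1, z (h.typ v)
  rw [Finset.sum_congr rfl fun β _ => expand β, ← Finset.sum_product']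
  -- Families with incompatible types at some block vertex have weight 0; the remaining ones are
  -- those that can be glued.
  rw [← Finset.sum_filter_of_ne (s := B ×ˢ Fintype.piFinset D)
    (p := fun x => ∀ w : S, CompatTypes (x.1.typ w) ((x.2 w).typ w))]
  swap
  · intro x _ hx w
    by_contra hc
    refine hx (Finset.prod_eq_zero (Finset.mem_univ w) ?_)
    rw [joinWeight, if_neg hc, zero_mul]
  have hcomp : ∀ (β : MarkedGraph V) (h : S → MarkedGraph V), β ∈ B →
      h ∈ Fintype.piFinset D → (∀ w : S, CompatTypes (β.typ w) ((h w).typ w)) →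
      Compatible (retractionPieces ρ S) fun o => o.elim β h := by
    intro β h hβ hh hc
    rw [Fintype.mem_piFinset] at hh
    refine ⟨?_, ?_⟩
    · rintro (_ | w)
      · exact ((hmemB β).1 hβ).1
      · exact ((hmemD w _).1 (hh w)).1
    · rintro (_ | w) (_ | w') v hjk hj hk
      · exact absurd rfl hjk
      · have hv : v = w' := Eq.trans (Eq.symm hj) hk
        subst hv
        exact hc w'
      · have hv : v = w := Eq.trans (Eq.symm hk) hj
        subst hv
        exact ⟨(hc w).1.symm, fun h => (hc w).2 ⟨h.2, h.1⟩⟩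
      · refine absurd ?_ hjk
        congr 1
        exact Subtype.ext (Eq.trans (Eq.symm hj) hk)
  refine Finset.sum_bij' (fun s _ => (s.restrict {v | ρ v = v},
      fun w : S => s.restrict {v | ρ v = w}))
    (fun p _ => glue fun o : Option S => o.elim p.1 p.2) ?_ ?_ ?_ ?_ ?_
  · intro s hs
    obtain ⟨h1, h2, h3, h4⟩ := mem_retractionSet.1 hs
    have hm := (h2.mem_iff h𝒢).1 h3
    have hc := compatible_restrict h1 hsub
    rw [Finset.mem_filter, Finset.mem_product, hmemB, Fintype.mem_piFinset]
    refine ⟨⟨⟨h1.restrict _, ⟨?_, ?_⟩, ?_⟩, fun w => (hmemD w _).2 ⟨h1.restrict _, ?_, ?_⟩⟩, ?_⟩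
    · exact (SimpleGraph.TwoConnOn.congr (SimpleGraph.induce_within _ le_rfl)).2 h2.block
    · change 𝒢.Mem ((s.g.within _).induce _)
      rw [SimpleGraph.induce_within _ le_rfl]
      exact hm.1
    · conv_rhs => rw [← h4, ← glue_retractionPieces hS h1 h2]
      rw [hc.typ_glue_of_unique (j := none) ((hroot r).2 rfl)]
      · rfl
      · rintro (_ | w) h
        · rfl
        · exact absurd (Eq.trans (Eq.symm h) ((hroot r).2 rfl)) ((hS _).1 w.2).1
    · exact (SimpleGraph.ConnOn.congr (SimpleGraph.induce_within _ le_rfl)).2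
        (h2.fiber _ ((hS _).1 w.2).2)
    · change 𝒢.Mem ((s.g.within _).induce _)
      rw [SimpleGraph.induce_within _ le_rfl]
      exact hm.2 _ ((hS _).1 w.2).2 ((hS _).1 w.2).1
    · intro w
      exact hc.types none (some w) w (by simp) ((hS _).1 w.2).2 ((hS _).1 w.2).2
  · rintro ⟨β, h⟩ hx
    rw [Finset.mem_filter, Finset.mem_product] at hx
    obtain ⟨⟨hβ, hh⟩, hc⟩ := hx
    have hC := hcomp β h hβ hh hc
    obtain ⟨-, ⟨hβ1, hβ2⟩, hβ3⟩ := (hmemB β).1 hβ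
    have eβ : (glue fun o : Option S => o.elim β h).restrict {v | ρ v = v} = β :=
      hC.restrict_glue hsub none
    have eh : ∀ w : S, (glue fun o : Option S => o.elim β h).restrict {v | ρ v = w} = h w :=
      fun w => hC.restrict_glue hsub (some w)
    have htyp : (glue fun o : Option S => o.elim β h).typ r = β.typ r := by
      refine hC.typ_glue_of_unique (j := none) ((hroot r).2 rfl) ?_
      rintro (_ | w) h
      · rfl
      · exact absurd (Eq.trans (Eq.symm h) ((hroot r).2 rfl)) ((hS _).1 w.2).1
    change (glue fun o : Option S => o.elim β h) ∈ _
    set s := glue fun o : Option S => o.elim β h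
    have gβ : β.g.induce {v | ρ v = v} = s.g.induce {v | ρ v = v} := by
      rw [← eβ]
      exact SimpleGraph.induce_within _ le_rfl
    have gh : ∀ w : S, (h w).g.induce {v | ρ v = w} = s.g.induce {v | ρ v = w} := fun w => by
      rw [← eh]
      exact SimpleGraph.induce_within _ le_rfl
    have hR : s.g.IsBlockRetraction r ρ := by
      refine ⟨hidem, hroot, (SimpleGraph.TwoConnOn.congr gβ).1 hβ1, ?_, ?_⟩
      · intro w hw
        by_cases hwr : w = r
        -- `S` omits the root, so no graph is attached there and its fiber is a single vertex.
        · have : {v | ρ v = w} = {r} := by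
            ext v
            rw [hwr]
            exact hroot v
          rw [this]
          exact SimpleGraph.connOn_of_base rfl fun v hv => by rw [Set.mem_singleton_iff.1 hv]
        · have hwS : w ∈ S := (hS w).2 ⟨hwr, hw⟩
          exact (SimpleGraph.ConnOn.congr (gh ⟨w, hwS⟩)).1
            ((hmemD _ _).1 (Fintype.mem_piFinset.1 hh ⟨w, hwS⟩)).2.1
      · rintro u v ⟨(_ | w), huv⟩
        · exact Or.inl ⟨(hC.on none).adj_mem _ _ huv, (hC.on none).adj_mem' huv⟩
        · have h1 : ρ u = w := (hC.on (some w)).adj_mem _ _ huv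
          have h2 : ρ v = w := (hC.on (some w)).adj_mem' huv
          exact Or.inr (h1.trans h2.symm)
    refine mem_retractionSet.2 ⟨hC.glue_isMatchedOn, hR, (hR.mem_iff h𝒢).2 ⟨?_, ?_⟩,
      htyp.trans hβ3⟩
    · rw [← gβ]
      exact hβ2
    · intro w hw hwr
      have hwS : w ∈ S := (hS w).2 ⟨hwr, hw⟩
      have := gh ⟨w, hwS⟩
      simp only at this
      rw [← this]
      exact ((hmemD _ _).1 (Fintype.mem_piFinset.1 hh ⟨w, hwS⟩)).2.2
  · intro s hs
    obtain ⟨h1, h2, -⟩ := mem_retractionSet.1 hs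
    refine Eq.trans ?_ (glue_retractionPieces hS h1 h2)
    congr 1
    funext o
    cases o <;> rfl
  · rintro ⟨β, h⟩ hx
    rw [Finset.mem_filter, Finset.mem_product] at hx
    have hC := hcomp β h hx.1.1 hx.1.2 hx.2
    exact Prod.ext (hC.restrict_glue hsub none) (funext fun w => hC.restrict_glue hsub (some w))
  · intro s hs
    obtain ⟨h1, h2, h3, h4⟩ := mem_retractionSet.1 hs
    have hc := compatible_restrict h1 hsub
    have hmaps : ∀ v ∈ Finset.univ.erase r, ρ v ∈ S := fun v hv =>
      hmapS v (Finset.mem_erase.1 hv).1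
    rw [← Finset.prod_fiberwise_of_maps_to hmaps, ← Finset.prod_coe_sort]
    refine Finset.prod_congr rfl fun w _ => ?_
    obtain ⟨hwr, hwf⟩ := (hS _).1 w.2
    have e : (Finset.univ.erase r).filter (fun v => ρ v = w) =
        insert w.1 ((Finset.univ.filter fun v => ρ v = w).erase w.1) := by
      ext v
      simp only [Finset.mem_filter, Finset.mem_erase, Finset.mem_univ, and_true, true_and,
        Finset.mem_insert]
      constructor
      · rintro ⟨-, hv⟩
        by_cases hvw : v = w
        · exact Or.inl hvw
        · exact Or.inr ⟨hvw, hv⟩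
      · rintro (rfl | ⟨-, hv⟩)
        · exact ⟨hwr, hwf⟩
        · refine ⟨?_, hv⟩
          rintro rfl
          exact hwr (hv.symm.trans ((hroot _).2 rfl))
    -- The vertex `w` is shared by the block and its attached graph, hence the factor `joinWeight`;
    -- the other vertices of the fiber keep their types from the attached graph.
    rw [e, Finset.prod_insert (by simp)]
    congr 1
    · refine Eq.trans ?_ (if_pos (hc.types none (some w) w (by simp) hwf hwf)).symm
      conv_lhs => rw [← glue_retractionPieces hS h1 h2]
      rw [hc.typ_glue_of_two (j := none) (k := some w) (by simp) hwf hwf]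
      · rfl
      · rintro (_ | w') h
        · exact Or.inl rfl
        · refine Or.inr (congrArg some (Subtype.ext ?_))
          exact Eq.trans (Eq.symm h) hwf
    · refine Finset.prod_congr rfl fun v hv => ?_
      rw [Finset.mem_erase, Finset.mem_filter] at hv
      conv_lhs => rw [← glue_retractionPieces hS h1 h2]
      rw [hc.typ_glue_of_unique (j := some w) hv.2.2]
      · rfl
      · rintro (_ | w') h
        · exact absurd (Eq.trans (Eq.symm h) hv.2.2) hv.1
        · exact congrArg some (Subtype.ext (Eq.trans (Eq.symm h) hv.2.2))

/-- Existence and uniqueness of the block retraction partition the graphs according to `ρ`. -/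
theorem branch_sum_eq [Fintype V] [DecidableEq V] (𝒢 : GraphClass)
    (r : V) (i : Fin 3) (z : Fin 3 → R) :
    𝒢.branch.sum i z Finset.univ r =
      open Classical in
      ∑ ρ : V → V with (∀ v, ρ (ρ v) = ρ v) ∧ ∀ v, ρ v = r ↔ v = r,
        ∑ s ∈ retractionSet 𝒢 r ρ i, ∏ v ∈ Finset.univ.erase r, z (s.typ v) := by
  classical
  rw [← Finset.sum_biUnion]
  · unfold RootedProp.sum rootedSum
    refine Finset.sum_congr ?_ fun _ _ => rfl
    ext s
    simp only [Finset.mem_filter, Finset.mem_univ, true_and, Finset.mem_biUnion,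
      mem_retractionSet, Finset.coe_univ, GraphClass.branch, ← Set.compl_eq_univ_sdiff]
    constructor
    · rintro ⟨h1, ⟨⟨h2, h3⟩, h4⟩, h5⟩
      obtain ⟨ρ, hρ⟩ := SimpleGraph.exists_isBlockRetraction h2 h3
      exact ⟨ρ, ⟨hρ.idem, hρ.root⟩, h1, hρ, h4, h5⟩
    · rintro ⟨ρ, -, h1, hρ, h4, h5⟩
      exact ⟨h1, ⟨⟨hρ.connOn_univ, hρ.connOn_compl_root⟩, h4⟩, h5⟩
  · intro ρ _ τ _ hne
    exact Finset.disjoint_left.2 fun s hs hs' =>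
      hne ((mem_retractionSet.1 hs).2.1.eq (mem_retractionSet.1 hs').2.1)

end MarkedGraph

/-! ### Exponential generating series over a `ℚ`-algebra. -/

section

open PowerSeries

section Egs

variable {R : Type*} [CommRing R] [Algebra ℚ R]

/-- The exponential generating series of a sequence. -/
noncomputable def egs (a : ℕ → R) : R⟦X⟧ := PowerSeries.mk fun n => algebraMap ℚ R (n ! : ℚ)⁻¹ * a n

theorem factorial_mul_algebraMap_inv (n : ℕ) : (n ! : R) * algebraMap ℚ R (n ! : ℚ)⁻¹ = 1 := by
  rw [← map_natCast (algebraMap ℚ R), ← map_mul, mul_inv_cancel₀, map_one]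
  exact_mod_cast n.factorial_ne_zero

theorem factorial_mul_coeff_egs (a : ℕ → R) (n : ℕ) : (n ! : R) * coeff n (egs a) = a n := by
  rw [egs, coeff_mk, ← mul_assoc, factorial_mul_algebraMap_inv, one_mul]

/-- Factorials are units in a `ℚ`-algebra. Identities of series can thus be checked after
multiplication by `n !`, where they count labelled structures. -/
theorem factorial_mul_cancel {n : ℕ} {x y : R} (h : (n ! : R) * x = (n ! : R) * y) : x = y := by
  have := congrArg (fun t => algebraMap ℚ R (n ! : ℚ)⁻¹ * t) h
  simpa only [← mul_assoc, mul_comm (algebraMap ℚ R _) (n ! : R), factorial_mul_algebraMap_inv,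
    one_mul] using this

theorem eq_egs_iff {f : R⟦X⟧} {a : ℕ → R} : f = egs a ↔ ∀ n, (n ! : R) * coeff n f = a n := by
  constructor
  · rintro rfl n
    exact factorial_mul_coeff_egs a n
  · intro h
    ext n
    exact factorial_mul_cancel ((h n).trans (factorial_mul_coeff_egs a n).symm)

theorem egs_sum {ι : Type*} (s : Finset ι) (c : ι → R) (a : ι → ℕ → R) :
    egs (fun n => ∑ t ∈ s, c t * a t n) = ∑ t ∈ s, PowerSeries.C (c t) * egs (a t) := by
  ext n
  simp only [egs, coeff_mk, map_sum, coeff_C_mul, Finset.mul_sum]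
  exact Finset.sum_congr rfl fun t _ => by ring

theorem factorial_mul_coeff_egs_mul (a : ℕ → R) (f : R⟦X⟧) (n : ℕ) :
    (n ! : R) * coeff n (egs a * f) =
      ∑ k ∈ Finset.range (n + 1), n.choose k • (a k * (((n - k)! : ℕ) * coeff (n - k) f)) := by
  rw [coeff_mul, Finset.Nat.sum_antidiagonal_eq_sum_range_succ_mk, Finset.mul_sum]
  refine Finset.sum_congr rfl fun k hk => ?_
  have hk' : k ≤ n := Nat.lt_succ_iff.1 (Finset.mem_range.1 hk)
  rw [← Nat.choose_mul_factorial_mul_factorial hk', nsmul_eq_mul, ← factorial_mul_coeff_egs a k]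
  push_cast
  ring

theorem sum_powerset_mul {V : Type*} (a : ℕ → R) (f : R⟦X⟧) (T : Finset V) :
    ∑ Y ∈ T.powerset, a Y.card * (((T.card - Y.card)! : ℕ) * coeff (T.card - Y.card) f) =
      (T.card ! : R) * coeff T.card (egs a * f) := by
  rw [factorial_mul_coeff_egs_mul, Finset.sum_powerset_apply_card
    (fun k => a k * (((T.card - k)! : ℕ) * coeff (T.card - k) f))]

theorem derivative_egs (a : ℕ → R) : d⁄dX R (egs a) = egs fun n => a (n + 1) := by
  rw [eq_egs_iff]
  intro n
  rw [coeff_derivative, ← factorial_mul_coeff_egs a (n + 1), Nat.factorial_succ]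
  push_cast
  ring

/-- A linear differential equation determines the coefficient of index `n + 1` from the lower ones,
because `n + 1` is invertible. -/
theorem eq_of_derivative_eq_mul {f g h : R⟦X⟧} (hf : d⁄dX R f = h * f) (hg : d⁄dX R g = h * g)
    (h0 : constantCoeff f = constantCoeff g) : f = g := by
  ext n
  induction n using Nat.strong_induction_on with
  | _ n ih =>
    cases n with
    | zero => simpa using h0
    | succ n =>
      have h1 := congrArg (coeff n) hf
      have h2 := congrArg (coeff n) hg
      rw [coeff_derivative, coeff_mul] at h1 h2
      have h3 : coeff (n + 1) f * ((n : R) + 1) = coeff (n + 1) g * ((n : R) + 1) := by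
        rw [h1, h2]
        refine Finset.sum_congr rfl fun p hp => ?_
        rw [ih p.2 (by have := Finset.HasAntidiagonal.mem_antidiagonal.1 hp; omega)]
      apply factorial_mul_cancel (n := n + 1)
      rw [Nat.factorial_succ]
      push_cast
      linear_combination (n ! : R) * h3

/-- The functions `ρ` that map `T` to `S` and fix everything else. -/
theorem mem_piFinset_ite {V : Type*} [Fintype V] [DecidableEq V] {S T : Finset V} {ρ : V → V} :
    ρ ∈ Fintype.piFinset (fun v => if v ∈ T then S else {v}) ↔
      (∀ v ∈ T, ρ v ∈ S) ∧ ∀ v ∉ T, ρ v = v := by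
  rw [Fintype.mem_piFinset]
  constructor
  · intro h
    exact ⟨fun v hv => by simpa [hv] using h v, fun v hv => by simpa [hv] using h v⟩
  · rintro ⟨h1, h2⟩ v
    split_ifs with hv
    · exact h1 v hv
    · exact Finset.mem_singleton.2 (h2 v hv)

/-- A map from `T` to `S` distributes the labels in `T` over the factors indexed by `S`; it is
extended by the identity in order to match the block retractions. In the induction on `S`, the fiber
over the new element is a subset `Y` of `T`. -/
theorem sum_piFinset_prod_fiber {V : Type*} [Fintype V] [DecidableEq V] (α : V → ℕ → R)
    (S : Finset V) : ∀ T : Finset V, Disjoint S T →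
    ∑ ρ ∈ Fintype.piFinset (fun v => if v ∈ T then S else {v}),
      ∏ w ∈ S, α w (T.filter fun v => ρ v = w).card =
      (T.card ! : R) * coeff T.card (∏ w ∈ S, egs (α w)) := by
  induction S using Finset.induction_on with
  | empty =>
    intro T _
    simp only [Finset.prod_empty, coeff_one]
    rcases T.eq_empty_or_nonempty with rfl | ⟨x, hx⟩
    · simp
    · rw [if_neg (Finset.card_ne_zero_of_mem hx), mul_zero]
      refine Finset.sum_eq_zero fun ρ hρ => ?_
      exact absurd ((mem_piFinset_ite.1 hρ).1 x hx) (Finset.notMem_empty _)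
  | insert a S ha ih =>
    intro T hT
    rw [Finset.disjoint_insert_left] at hT
    obtain ⟨haT, hST⟩ := hT
    have hne : ∀ w ∈ S, w ≠ a := fun w hw h => ha (h ▸ hw)
    rw [Finset.prod_insert ha, ← sum_powerset_mul]
    have step : ∀ Y ∈ T.powerset,
        α a Y.card * (((T.card - Y.card)! : ℕ) * coeff (T.card - Y.card) (∏ w ∈ S, egs (α w))) =
        ∑ ρ ∈ Fintype.piFinset (fun v => if v ∈ T \ Y then S else {v}),
          α a Y.card * ∏ w ∈ S, α w ((T \ Y).filter fun v => ρ v = w).card := by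
      intro Y hY
      rw [← Finset.mul_sum, ih _ (hST.mono_right Finset.sdiff_subset),
        Finset.card_sdiff_of_subset (Finset.mem_powerset.1 hY)]
    rw [Finset.sum_congr rfl step, Finset.sum_sigma']
    -- Points sent to `a` are reset to themselves, since a map defined on `T \ Y` has to fix
    -- everything else.
    refine Finset.sum_bij' (fun ρ _ =>
      ⟨T.filter fun v => ρ v = a, fun v => if ρ v = a then v else ρ v⟩)
      (fun p _ => fun v => if v ∈ p.1 then a else p.2 v) ?_ ?_ ?_ ?_ ?_
    · intro ρ hρ
      obtain ⟨h1, h2⟩ := mem_piFinset_ite.1 hρ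
      rw [Finset.mem_sigma]
      refine ⟨Finset.mem_powerset.2 (Finset.filter_subset _ _), mem_piFinset_ite.2 ⟨?_, ?_⟩⟩
      · intro v hv
        simp only [Finset.mem_sdiff, Finset.mem_filter, not_and] at hv
        have h3 := hv.2 hv.1
        simp only [if_neg h3]
        exact (Finset.mem_insert.1 (h1 v hv.1)).resolve_left h3
      · intro v hv
        by_cases hvT : v ∈ T
        · have hva : ρ v = a := by
            by_contra hva
            exact hv (Finset.mem_sdiff.2 ⟨hvT, fun h => hva (Finset.mem_filter.1 h).2⟩)
          simp only [if_pos hva]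
        · simp only [h2 v hvT, ite_self]
    · rintro ⟨Y, ρ⟩ hp
      rw [Finset.mem_sigma, Finset.mem_powerset] at hp
      obtain ⟨hY, hρ⟩ := hp
      obtain ⟨h1, h2⟩ := mem_piFinset_ite.1 hρ
      refine mem_piFinset_ite.2 ⟨fun v hv => ?_, fun v hv => ?_⟩
      · by_cases hvY : v ∈ Y
        · simp [hvY]
        · simp only [if_neg hvY]
          exact Finset.mem_insert_of_mem (h1 v (Finset.mem_sdiff.2 ⟨hv, hvY⟩))
      · simp only [if_neg fun h => hv (hY h)]
        exact h2 v fun h => hv (Finset.mem_sdiff.1 h).1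
    · intro ρ hρ
      obtain ⟨h1, h2⟩ := mem_piFinset_ite.1 hρ
      funext v
      by_cases hvT : v ∈ T
      · by_cases hva : ρ v = a
        · simp [hvT, hva]
        · simp [hva]
      · simp [hvT, h2 v hvT]
    · rintro ⟨Y, ρ⟩ hp
      rw [Finset.mem_sigma, Finset.mem_powerset] at hp
      obtain ⟨hY, hρ⟩ := hp
      obtain ⟨h1, h2⟩ := mem_piFinset_ite.1 hρ
      have key : ∀ v ∉ Y, v ∈ T → ρ v ≠ a := fun v hv hvT =>
        hne _ (h1 v (Finset.mem_sdiff.2 ⟨hvT, hv⟩))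
      have e1 : (T.filter fun v => (if v ∈ Y then a else ρ v) = a) = Y := by
        ext v
        rw [Finset.mem_filter]
        by_cases hvY : v ∈ Y
        · simp [hvY, hY hvY]
        · simp only [hvY, iff_false, not_and]
          exact key v hvY
      have e2 : (fun v => if (if v ∈ Y then a else ρ v) = a then v else
          if v ∈ Y then a else ρ v) = ρ := by
        funext v
        by_cases hvY : v ∈ Y
        · simp only [if_pos hvY, if_true]
          exact (h2 v fun h => (Finset.mem_sdiff.1 h).2 hvY).symm
        · simp only [if_neg hvY]
          split_ifs with hva
          · exact (h2 v fun h => key v hvY (Finset.mem_sdiff.1 h).1 hva).symm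
          · rfl
      simp only [e1, e2]
    · intro ρ hρ
      rw [Finset.prod_insert ha]
      congr 1
      refine Finset.prod_congr rfl fun w hw => ?_
      congr 2
      ext v
      simp only [Finset.mem_filter, Finset.mem_sdiff, not_and]
      constructor
      · rintro ⟨hvT, rfl⟩
        exact ⟨⟨hvT, fun _ => hne _ hw⟩, if_neg (hne _ hw)⟩
      · rintro ⟨⟨hvT, h⟩, h'⟩
        rw [if_neg (h hvT)] at h'
        exact ⟨hvT, h'⟩

end Egs

/-! ### The equations between the connected, branch and block series. -/

namespace GraphClass

variable {𝒢 : GraphClass} {R : Type*} [CommRing R]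

/-- A branch minus its root is connected, hence nonempty. -/
theorem branch_seq_zero (i : Fin 3) (z : Fin 3 → R) : 𝒢.branch.seq i z 0 = 0 := by
  classical
  have : Subsingleton (Fin (0 + 1)) := inferInstanceAs (Subsingleton (Fin 1))
  refine Finset.sum_eq_zero fun s hs => ?_
  obtain ⟨x, -, hx⟩ := (Finset.mem_filter.1 hs).2.2.1.1.2.1
  exact absurd (Subsingleton.elim x _) hx

/-- A single vertex has no blocks, so block-stability applies vacuously. -/
theorem mem_of_subsingleton (h𝒢 : 𝒢.BlockStable) (g : SimpleGraph (Fin 1)) : 𝒢.Mem g := by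
  rw [mem_fin_iff, h𝒢.mem_iff 1 g SimpleGraph.Connected.of_subsingleton]
  intro H hH
  obtain ⟨x, -, y, -, hxy⟩ := hH.eq_induce.2.1.1
  exact absurd (Subsingleton.elim x y) hxy

theorem conn_seq_zero (h𝒢 : 𝒢.BlockStable) {i : Fin 3} (hi : i ≠ 1) (z : Fin 3 → R) :
    𝒢.conn.seq i z 0 = 1 := by
  classical
  have : Subsingleton (Fin (0 + 1)) := inferInstanceAs (Subsingleton (Fin 1))
  have hbot : ∀ g : SimpleGraph (Fin 1), ∀ u v, ¬ g.Adj u v := fun g u v h =>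
    h.ne (Subsingleton.elim u v)
  unfold RootedProp.seq RootedProp.sum rootedSum
  rw [Finset.sum_eq_single (⟨⊥, ⊥, {v | i = 0}⟩ : MarkedGraph (Fin 1))]
  · refine Finset.prod_eq_one fun v hv => ?_
    exact absurd (Subsingleton.elim v _) (Finset.mem_erase.1 hv).1
  · intro s hs hne
    refine absurd ?_ hne
    obtain ⟨h1, h2, h3⟩ := (Finset.mem_filter.1 hs).2
    apply MarkedGraph.ext
    · ext u v
      exact iff_of_false (hbot _ u v) (hbot _ u v)
    · ext u v
      exact iff_of_false (hbot _ u v) (hbot _ u v)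
    · ext v
      obtain rfl : v = Fin.last 0 := Subsingleton.elim _ _
      rw [← typ_eq_zero, h3]
      rfl
  · intro h
    refine absurd (Finset.mem_filter.2
      ⟨Finset.mem_univ _, ⟨?_, ?_, ?_, ?_, ?_, ?_⟩, ⟨?_, ?_⟩, ?_⟩) h
    · exact fun u v h => absurd h (hbot _ u v)
    · exact le_rfl
    · exact fun u v w h => absurd h (hbot _ u v)
    · simp
    · exact fun u v _ _ h => absurd h (hbot _ u v)
    · exact fun u v _ h => absurd h (hbot _ u v)
    · rw [Finset.coe_univ]
      exact SimpleGraph.connected_iff_connOn_univ.1 SimpleGraph.Connected.of_subsingleton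
    · rw [Finset.coe_univ, ← mem_congr (SimpleGraph.induceUnivIso _).symm]
      exact mem_of_subsingleton h𝒢 _
    · unfold typ
      split_ifs with h1 h2
      · exact h1.symm
      · obtain ⟨w, hw⟩ := h2
        exact absurd hw (hbot _ _ _)
      · have key : ∀ i : Fin 3, i ≠ 1 → i ≠ 0 → 2 = i := by decide
        exact key i hi h1

variable [Algebra ℚ R]

/-- Differentiation reserves one extra label `u`. In the product, `u` is the reserved label of the
branch containing it, and the other factor is the rest of the graph. -/
theorem derivative_egs_conn (h𝒢 : 𝒢.BlockStable) {i : Fin 3} (hi : i ≠ 1) (z : Fin 3 → R) :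
    d⁄dX R (egs (𝒢.conn.seq i z)) = d⁄dX R (egs (𝒢.branch.seq i z)) * egs (𝒢.conn.seq i z) := by
  rw [derivative_egs, derivative_egs]
  symm
  rw [eq_egs_iff]
  intro n
  let r : Fin (n + 2) := Fin.last (n + 1)
  let u : Fin (n + 2) := 0
  have hur : u ≠ r := by
    intro h
    have := congrArg Fin.val h
    simp [u, r] at this
  let T : Finset (Fin (n + 2)) := (Finset.univ.erase r).erase u
  have hT : T.card = n := by
    rw [Finset.card_erase_of_mem (Finset.mem_erase.2 ⟨hur, Finset.mem_univ _⟩),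
      Finset.card_erase_of_mem (Finset.mem_univ _), Finset.card_univ, Fintype.card_fin]
    omega
  have h1 : 𝒢.conn.seq i z (n + 1) = _ := conn_sum_eq_of_ne_one h𝒢 hur hi z
  have h2 := sum_powerset_mul (fun n => 𝒢.branch.seq i z (n + 1)) (egs (𝒢.conn.seq i z)) T
  rw [hT] at h2
  rw [h1, ← h2]
  -- `Y` is the branch without its reserved vertex, which accounts for the index shift in the
  -- derivative.
  refine Finset.sum_bij' (fun Y _ => insert u Y) (fun A _ => A.erase u) ?_ ?_ ?_ ?_ ?_
  · intro Y hY
    have hY := Finset.mem_powerset.1 hY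
    refine Finset.mem_filter.2 ⟨Finset.mem_univ _, Finset.mem_insert_self _ _, fun h => ?_⟩
    rcases Finset.mem_insert.1 h with h | h
    · exact hur h.symm
    · exact (Finset.mem_erase.1 (Finset.mem_erase.1 (hY h)).2).1 rfl
  · intro A hA
    obtain ⟨-, h3, h4⟩ := Finset.mem_filter.1 hA
    refine Finset.mem_powerset.2 fun x hx => ?_
    obtain ⟨h5, h6⟩ := Finset.mem_erase.1 hx
    refine Finset.mem_erase.2 ⟨h5, Finset.mem_erase.2 ⟨?_, Finset.mem_univ _⟩⟩
    rintro rfl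
    exact h4 h6
  · intro Y hY
    refine Finset.erase_insert fun h => ?_
    exact (Finset.mem_erase.1 (Finset.mem_powerset.1 hY h)).1 rfl
  · intro A hA
    exact Finset.insert_erase (Finset.mem_filter.1 hA).2.1
  · intro Y hY
    have hY := Finset.mem_powerset.1 hY
    have huY : u ∉ Y := fun h => (Finset.mem_erase.1 (hY h)).1 rfl
    have hrA : r ∉ insert u Y := fun h => by
      rcases Finset.mem_insert.1 h with h | h
      · exact hur h.symm
      · exact (Finset.mem_erase.1 (Finset.mem_erase.1 (hY h)).2).1 rfl
    have hle : Y.card ≤ n := (Finset.card_le_card hY).trans_eq hT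
    rw [RootedProp.sum_eq_seq _ _ _ (Finset.mem_insert_self _ _), Finset.erase_insert hrA,
      RootedProp.sum_eq_seq _ _ _ (Finset.mem_compl.2 hrA),
      Finset.card_erase_of_mem (Finset.mem_compl.2 hrA), Finset.card_compl,
      Finset.card_insert_of_notMem huY, Fintype.card_fin, factorial_mul_coeff_egs]
    congr 2
    omega

/-- The matching itself selects the branch, so no label is reserved and the product appears without
derivatives. -/
theorem egs_conn_one (h𝒢 : 𝒢.BlockStable) (z : Fin 3 → R) :
    egs (𝒢.conn.seq 1 z) = egs (𝒢.branch.seq 1 z) * egs (𝒢.conn.seq 2 z) := by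
  symm
  rw [eq_egs_iff]
  intro n
  let r : Fin (n + 1) := Fin.last n
  let T : Finset (Fin (n + 1)) := Finset.univ.erase r
  have hT : T.card = n := by
    rw [Finset.card_erase_of_mem (Finset.mem_univ _), Finset.card_univ, Fintype.card_fin]
    omega
  have h1 : 𝒢.conn.seq 1 z n = _ := conn_sum_one h𝒢 r z
  have h2 := sum_powerset_mul (𝒢.branch.seq 1 z) (egs (𝒢.conn.seq 2 z)) T
  rw [hT] at h2
  have hset : T.powerset = Finset.univ.filter fun A => r ∉ A := by
    ext A
    rw [Finset.mem_powerset, Finset.mem_filter, Finset.subset_erase]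
    simp
  rw [h1, ← h2, hset]
  refine Finset.sum_congr rfl fun Y hY => ?_
  have hr : r ∉ Y := (Finset.mem_filter.1 hY).2
  rw [RootedProp.sum_eq_seq _ _ _ (Finset.mem_insert_self _ _), Finset.erase_insert hr,
    RootedProp.sum_eq_seq _ _ _ (Finset.mem_compl.2 hr),
    Finset.card_erase_of_mem (Finset.mem_compl.2 hr), Finset.card_compl, Fintype.card_fin,
    factorial_mul_coeff_egs]
  congr 2
  omega

/-- The series by which a vertex of type `t` of the block containing the root is replaced. -/
noncomputable def joinSeries (𝒢 : GraphClass) (z : Fin 3 → R) (t : Fin 3) : R⟦X⟧ :=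
  ∑ t', PowerSeries.C (joinWeight z t t') * egs (𝒢.conn.seq t' z)

/-- Here `k` counts the block vertices other than the root. The block weights `joinSeries` are
themselves power series, and their coefficient of index `N - k` distributes the remaining labels
over the attached graphs. -/
theorem branch_seq_eq (h𝒢 : 𝒢.BlockStable) (i : Fin 3) (z : Fin 3 → R) (N : ℕ) :
    𝒢.branch.seq i z N = ∑ k ∈ Finset.range (N + 1),
      N.choose k • (((N - k)! : ℕ) * coeff (N - k) (𝒢.block.seq i (𝒢.joinSeries z) k)) := by
  classical
  let r : Fin (N + 1) := Fin.last N
  have hcard : (Finset.univ.erase r).card = N := by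
    rw [Finset.card_erase_of_mem (Finset.mem_univ _), Finset.card_univ, Fintype.card_fin]
    omega
  have h1 : 𝒢.branch.seq i z N = _ := branch_sum_eq 𝒢 r i z
  have h2 := Finset.sum_powerset_apply_card (fun k => ((((N - k)! : ℕ) : R) *
    coeff (N - k) (𝒢.block.seq i (𝒢.joinSeries z) k)))
    (x := Finset.univ.erase r)
  rw [hcard] at h2
  rw [h1, ← h2, ← Finset.sum_fiberwise_of_maps_to
    (g := fun ρ : Fin (N + 1) → Fin (N + 1) => (Finset.univ.filter fun v => ρ v = v).erase r)
    (t := (Finset.univ.erase r).powerset)]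
  swap
  · intro ρ _
    exact Finset.mem_powerset.2 (Finset.erase_subset_erase _ (Finset.subset_univ _))
  refine Finset.sum_congr rfl fun S hS => ?_
  have hrS : r ∉ S := fun h => (Finset.mem_erase.1 (Finset.mem_powerset.1 hS h)).1 rfl
  let T : Finset (Fin (N + 1)) := (insert r S)ᶜ
  have hTcard : T.card = N - S.card := by
    rw [Finset.card_compl, Finset.card_insert_of_notMem hrS, Fintype.card_fin]
    omega
  have hST : Disjoint S T :=
    Finset.disjoint_left.2 fun v hv hv' => Finset.mem_compl.1 hv' (Finset.mem_insert_of_mem hv)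
  -- Once the fixed points are `r` and `S`, the other vertices may be sent anywhere in `S`, but not
  -- to `r`.
  have hset : (Finset.univ.filter fun ρ : Fin (N + 1) → Fin (N + 1) =>
        (∀ v, ρ (ρ v) = ρ v) ∧ ∀ v, ρ v = r ↔ v = r).filter
        (fun ρ => (Finset.univ.filter fun v => ρ v = v).erase r = S) =
      Fintype.piFinset fun v => if v ∈ T then S else {v} := by
    ext ρ
    rw [Finset.mem_filter, Finset.mem_filter, mem_piFinset_ite]
    constructor
    · rintro ⟨⟨-, hidem, hroot⟩, rfl⟩
      refine ⟨fun v hv => ?_, fun v hv => ?_⟩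
      · rw [Finset.mem_compl, Finset.mem_insert, not_or] at hv
        exact Finset.mem_erase.2 ⟨fun h => hv.1 ((hroot v).1 h), by simp [hidem]⟩
      · rw [Finset.mem_compl, not_not, Finset.mem_insert] at hv
        rcases hv with rfl | hv
        · exact (hroot _).2 rfl
        · simpa using (Finset.mem_erase.1 hv).2
    · rintro ⟨ha, hb⟩
      have hr : ρ r = r := hb r (by simp [T])
      have hs : ∀ v ∈ S, ρ v = v := fun v hv => hb v (by simp [T, hv])
      have hmem : ∀ v, v = r ∨ v ∈ S ∨ v ∈ T := fun v => by
        simp only [T, Finset.mem_compl, Finset.mem_insert]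
        tauto
      refine ⟨⟨Finset.mem_univ _, fun v => ?_, fun v => ⟨fun hv => ?_, ?_⟩⟩, ?_⟩
      · rcases hmem v with rfl | hv | hv
        · rw [hr, hr]
        · rw [hs v hv, hs v hv]
        · exact hs _ (ha v hv)
      · rcases hmem v with rfl | h | h
        · rfl
        · rw [← hs v h, hv]
        · exact absurd (hv ▸ ha v h) hrS
      · rintro rfl
        exact hr
      · ext v
        simp only [Finset.mem_erase, Finset.mem_filter, Finset.mem_univ, true_and]
        constructor
        · rintro ⟨h3, h4⟩
          rcases hmem v with h | h | h
          · exact absurd h h3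
          · exact h
          · exact h4 ▸ ha v h
        · intro hv
          exact ⟨fun h => hrS (h ▸ hv), hs v hv⟩
  refine (Finset.sum_congr (Eq.trans (by ext; simp only [Finset.mem_filter]) hset)
    fun _ _ => rfl).trans ?_
  have hF : ∀ ρ ∈ Fintype.piFinset (fun v => if v ∈ T then S else {v}), ∀ v,
      v ∈ insert r S ↔ ρ v = v := by
    intro ρ hρ v
    obtain ⟨ha, hb⟩ := mem_piFinset_ite.1 hρ
    constructor
    · intro hv
      exact hb v fun h => Finset.mem_compl.1 h hv
    · intro hv
      by_contra h
      exact h (Finset.mem_insert_of_mem (hv ▸ ha v (Finset.mem_compl.2 h)))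
  have hinner : ∀ ρ ∈ Fintype.piFinset (fun v => if v ∈ T then S else {v}),
      ∑ s ∈ retractionSet 𝒢 r ρ i, ∏ v ∈ Finset.univ.erase r, z (s.typ v) =
      ∑ β : MarkedGraph (Fin (N + 1)) with β.IsMatchedOn (insert r S : Finset _) ∧
          𝒢.block.holds (insert r S : Finset _) r β.g ∧ β.typ r = i,
        ∏ w ∈ S, ∑ t, joinWeight z (β.typ w) t *
          𝒢.conn.seq t z (T.filter fun v => ρ v = w).card := by
    intro ρ hρ
    have hv := (Finset.mem_filter.1 (Finset.mem_filter.1 (hset ▸ hρ)).1).2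
    rw [sum_retractionSet h𝒢 hv.1 hv.2 i z (insert r S) (hF ρ hρ)]
    refine Finset.sum_congr rfl fun β _ => ?_
    rw [Finset.erase_insert hrS]
    refine Finset.prod_congr rfl fun w hw => Finset.sum_congr rfl fun t _ => ?_
    have hww : ρ w = w := (hF ρ hρ w).1 (Finset.mem_insert_of_mem hw)
    rw [RootedProp.sum_eq_seq _ _ _ (by simpa using hww)]
    congr 3
    ext v
    simp only [Finset.mem_erase, Finset.mem_filter, Finset.mem_univ, true_and]
    refine and_congr_left fun h3 => ?_
    constructor
    · intro h4
      rw [Finset.mem_compl]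
      exact fun h => h4 (((hF ρ hρ v).1 h).symm.trans h3)
    · rintro h4 rfl
      exact Finset.disjoint_left.1 hST hw h4
  rw [Finset.sum_congr rfl hinner, Finset.sum_comm]
  have hblock : 𝒢.block.seq i (𝒢.joinSeries z) S.card =
      𝒢.block.sum i (𝒢.joinSeries z) (insert r S) r := by
    rw [RootedProp.sum_eq_seq _ _ _ (Finset.mem_insert_self _ _), Finset.erase_insert hrS]
  rw [hblock]
  unfold RootedProp.sum rootedSum
  rw [map_sum, Finset.mul_sum]
  refine Finset.sum_congr rfl fun β _ => ?_
  rw [Finset.erase_insert hrS, ← hTcard]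
  rw [sum_piFinset_prod_fiber (fun w n => ∑ t, joinWeight z (β.typ w) t * 𝒢.conn.seq t z n) S T hST]
  simp only [egs_sum, joinSeries]

theorem coeff_egs_branch (h𝒢 : 𝒢.BlockStable) (i : Fin 3) (z : Fin 3 → R) (N : ℕ) :
    coeff N (egs (𝒢.branch.seq i z)) = ∑ k ∈ Finset.range (N + 1),
      algebraMap ℚ R (k ! : ℚ)⁻¹ * coeff (N - k) (𝒢.block.seq i (𝒢.joinSeries z) k) := by
  apply factorial_mul_cancel (n := N)
  rw [factorial_mul_coeff_egs, branch_seq_eq h𝒢, Finset.mul_sum]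
  refine Finset.sum_congr rfl fun k hk => ?_
  have hk' : k ≤ N := Nat.lt_succ_iff.1 (Finset.mem_range.1 hk)
  have h1 := factorial_mul_algebraMap_inv (R := R) k
  rw [← Nat.choose_mul_factorial_mul_factorial hk', nsmul_eq_mul]
  push_cast
  linear_combination (-(N.choose k : R) * ((N - k)! : ℕ) *
    coeff (N - k) (𝒢.block.seq i (𝒢.joinSeries z) k)) * h1

/-- Both sides solve `f' = b' f`, where `b` is the branch series, and have constant term 1. -/
theorem egs_conn_eq_exp (h𝒢 : 𝒢.BlockStable) {i : Fin 3} (hi : i ≠ 1) (z : Fin 3 → R) :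
    egs (𝒢.conn.seq i z) = (PowerSeries.exp R).subst (egs (𝒢.branch.seq i z)) := by
  have h0 : constantCoeff (egs (𝒢.branch.seq i z)) = 0 := by
    rw [← coeff_zero_eq_constantCoeff_apply, egs, coeff_mk, branch_seq_zero, mul_zero]
  have hs : PowerSeries.HasSubst (egs (𝒢.branch.seq i z)) :=
    PowerSeries.HasSubst.of_constantCoeff_zero' h0
  refine eq_of_derivative_eq_mul (derivative_egs_conn h𝒢 hi z) ?_ ?_
  · rw [derivative_subst hs, derivative_exp, mul_comm]
  · have h1 : constantCoeff (egs (𝒢.conn.seq i z)) = 1 := by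
      rw [← coeff_zero_eq_constantCoeff_apply, egs, coeff_mk, conn_seq_zero h𝒢 hi]
      simp
    rw [h1, ← coeff_zero_eq_constantCoeff_apply, coeff_subst' hs, finsum_eq_single _ 0]
    · simp
    · intro n hn
      rw [coeff_zero_eq_constantCoeff_apply, map_pow, h0, zero_pow hn, smul_zero]

end GraphClass

end

/-! ### Putting `x` for the auxiliary variable. -/

section SubstX

/-- The substitution of the first variable for the variable of a power series over
`MvPowerSeries (Fin 3) ℚ`, as a function. -/
noncomputable def substXFun (A : PowerSeries (MvPowerSeries (Fin 3) ℚ)) :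
    MvPowerSeries (Fin 3) ℚ :=
  fun e => MvPowerSeries.coeff e
    (Polynomial.eval (MvPowerSeries.X 0) (PowerSeries.trunc (e 0 + 1) A))

theorem eval_trunc_eq_sum (A : PowerSeries (MvPowerSeries (Fin 3) ℚ)) (M : ℕ) :
    Polynomial.eval (MvPowerSeries.X 0) (PowerSeries.trunc M A) =
      ∑ n ∈ Finset.range M, PowerSeries.coeff n A * MvPowerSeries.X 0 ^ n := by
  exact PowerSeries.eval₂_trunc_eq_sum_range _ (RingHom.id _) _ _

/-- Terms with `n > e 0` are divisible by too high a power of `X 0` to contribute, so every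
truncation beyond `e 0` gives the same coefficient. -/
theorem coeff_substXFun (A : PowerSeries (MvPowerSeries (Fin 3) ℚ)) {M : ℕ} {e : Fin 3 →₀ ℕ}
    (he : e 0 < M) : MvPowerSeries.coeff e (substXFun A) =
      MvPowerSeries.coeff e (∑ n ∈ Finset.range M,
        PowerSeries.coeff n A * MvPowerSeries.X 0 ^ n) := by
  change MvPowerSeries.coeff e (Polynomial.eval (MvPowerSeries.X 0)
    (PowerSeries.trunc (e 0 + 1) A)) = _
  rw [eval_trunc_eq_sum, map_sum, map_sum]
  refine Finset.sum_subset (Finset.range_mono he) fun n _ hn => ?_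
  have hn' : e 0 < n := by simpa using hn
  exact MvPowerSeries.X_pow_dvd_iff.1 (dvd_mul_left _ _) e hn'

theorem X_pow_dvd_substXFun_sub (A : PowerSeries (MvPowerSeries (Fin 3) ℚ)) (M : ℕ) :
    MvPowerSeries.X 0 ^ M ∣ substXFun A -
      Polynomial.eval (MvPowerSeries.X 0) (PowerSeries.trunc M A) := by
  rw [MvPowerSeries.X_pow_dvd_iff]
  intro e he
  rw [map_sub, coeff_substXFun A he, eval_trunc_eq_sum, sub_self]

theorem eq_of_forall_X_pow_dvd {f g : MvPowerSeries (Fin 3) ℚ}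
    (h : ∀ M : ℕ, MvPowerSeries.X 0 ^ M ∣ f - g) : f = g := by
  ext e
  have := MvPowerSeries.X_pow_dvd_iff.1 (h (e 0 + 1)) e (Nat.lt_succ_self _)
  rwa [map_sub, sub_eq_zero] at this

/-- The substitution of the first variable for the variable of a power series over
`MvPowerSeries (Fin 3) ℚ`. -/
noncomputable def substX : PowerSeries (MvPowerSeries (Fin 3) ℚ) →+* MvPowerSeries (Fin 3) ℚ where
  toFun := substXFun
  map_zero' := by
    ext e
    rw [coeff_substXFun 0 (Nat.lt_succ_self _)]
    simp
  map_one' := by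
    ext e
    rw [coeff_substXFun 1 (Nat.lt_succ_self _), Finset.sum_eq_single 0]
    · simp
    · intro n _ hn
      simp [PowerSeries.coeff_one, hn]
    · simp
  map_add' A B := by
    ext e
    rw [map_add, coeff_substXFun _ (Nat.lt_succ_self _), coeff_substXFun _ (Nat.lt_succ_self _),
      coeff_substXFun _ (Nat.lt_succ_self _), ← map_add, ← Finset.sum_add_distrib]
    simp only [map_add, add_mul]
  -- Modulo `X 0 ^ M` the substitution is evaluation of the truncation, and truncation is
  -- multiplicative up to a multiple of the `M`-th power of the variable.
  map_mul' A B := by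
    refine eq_of_forall_X_pow_dvd fun M => ?_
    obtain ⟨a, ha⟩ := X_pow_dvd_substXFun_sub A M
    obtain ⟨b, hb⟩ := X_pow_dvd_substXFun_sub B M
    obtain ⟨c, hc⟩ := X_pow_dvd_substXFun_sub (A * B) M
    have hpoly : Polynomial.X ^ M ∣ PowerSeries.trunc M A * PowerSeries.trunc M B -
        PowerSeries.trunc M (A * B) := by
      rw [Polynomial.X_pow_dvd_iff]
      intro d hd
      rw [Polynomial.coeff_sub, PowerSeries.coeff_trunc, if_pos hd,
        PowerSeries.coeff_mul_eq_coeff_trunc_mul_trunc A B hd, ← Polynomial.coeff_coe,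
        Polynomial.coe_mul, sub_self]
    obtain ⟨q, hq⟩ := hpoly
    have hq' := congrArg (Polynomial.eval (MvPowerSeries.X 0 : MvPowerSeries (Fin 3) ℚ)) hq
    simp only [Polynomial.eval_sub, Polynomial.eval_mul, Polynomial.eval_pow,
      Polynomial.eval_X] at hq'
    refine ⟨c - a * substXFun B -
      Polynomial.eval (MvPowerSeries.X 0) (PowerSeries.trunc M A) * b -
      Polynomial.eval (MvPowerSeries.X 0) q, ?_⟩
    linear_combination hc - ha * substXFun B -
      Polynomial.eval (MvPowerSeries.X 0) (PowerSeries.trunc M A) * hb - hq'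

theorem coeff_substX (A : PowerSeries (MvPowerSeries (Fin 3) ℚ)) {M : ℕ} {e : Fin 3 →₀ ℕ}
    (he : e 0 < M) : MvPowerSeries.coeff e (substX A) =
      MvPowerSeries.coeff e (∑ n ∈ Finset.range M,
        PowerSeries.coeff n A * MvPowerSeries.X 0 ^ n) := coeff_substXFun A he

theorem substX_C (c : MvPowerSeries (Fin 3) ℚ) : substX (PowerSeries.C c) = c := by
  ext e
  rw [coeff_substX _ (Nat.lt_succ_self _), Finset.sum_eq_single 0]
  · simp
  · intro n _ hn
    simp [PowerSeries.coeff_C, hn]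
  · simp

theorem substX_X : substX PowerSeries.X = MvPowerSeries.X 0 := by
  ext e
  rw [coeff_substX _ (M := e 0 + 2) (by omega), Finset.sum_eq_single 1]
  · simp
  · intro n _ hn
    simp [PowerSeries.coeff_X, hn]
  · simp

theorem X_pow_dvd_substX {A : PowerSeries (MvPowerSeries (Fin 3) ℚ)} {M : ℕ}
    (h : PowerSeries.X ^ M ∣ A) : MvPowerSeries.X 0 ^ M ∣ substX A := by
  have := map_dvd substX h
  rwa [map_pow, substX_X] at this

/-- As `F` is divisible by the variable, only the first `M` terms of either exponential matter
modulo the `M`-th power. -/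
theorem substX_exp {F : PowerSeries (MvPowerSeries (Fin 3) ℚ)}
    (hF : PowerSeries.constantCoeff F = 0) :
    substX ((PowerSeries.exp (MvPowerSeries (Fin 3) ℚ)).subst F) = expSeries (substX F) ∧
      PowerSeries.HasSubst (substX F) := by
  have hX : PowerSeries.X ∣ F := PowerSeries.X_dvd_iff.2 hF
  have hX' : MvPowerSeries.X 0 ∣ substX F := by
    have := map_dvd substX hX
    rwa [substX_X] at this
  have hs := PowerSeries.HasSubst.of_constantCoeff_zero' hF
  have hF0 : MvPowerSeries.constantCoeff (substX F) = 0 := by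
    obtain ⟨q, hq⟩ := hX'
    rw [hq, map_mul, MvPowerSeries.constantCoeff_X, zero_mul]
  have hs' : PowerSeries.HasSubst (substX F) := PowerSeries.HasSubst.of_constantCoeff_zero hF0
  refine ⟨eq_of_forall_X_pow_dvd fun M => ?_, hs'⟩
  let E : PowerSeries (MvPowerSeries (Fin 3) ℚ) :=
    ∑ d ∈ Finset.range M, PowerSeries.C (algebraMap ℚ _ (1 / d ! : ℚ)) * F ^ d
  have h1 : PowerSeries.X ^ M ∣ (PowerSeries.exp (MvPowerSeries (Fin 3) ℚ)).subst F - E := by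
    rw [PowerSeries.X_pow_dvd_iff]
    intro n hn
    rw [map_sub, PowerSeries.coeff_subst' hs, finsum_eq_sum_of_support_subset (s := Finset.range M),
      map_sum, sub_eq_zero]
    · refine Finset.sum_congr rfl fun d _ => ?_
      rw [PowerSeries.coeff_exp, PowerSeries.coeff_C_mul, smul_eq_mul]
    · intro d hd
      rw [Finset.coe_range, Set.mem_Iio]
      by_contra hdM
      refine hd ?_
      change _ • PowerSeries.coeff n (F ^ d) = 0
      rw [PowerSeries.X_pow_dvd_iff.1 (pow_dvd_pow_of_dvd hX d) n (by omega), smul_zero]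
  have h2 : MvPowerSeries.X 0 ^ M ∣ expSeries (substX F) - substX E := by
    rw [MvPowerSeries.X_pow_dvd_iff]
    intro e he
    rw [map_sub, expSeries, PowerSeries.coeff_subst hs',
      finsum_eq_sum_of_support_subset (s := Finset.range M), map_sum, map_sum, sub_eq_zero]
    · refine Finset.sum_congr rfl fun d _ => ?_
      rw [PowerSeries.coeff_exp, map_mul substX, map_pow substX, substX_C,
        MvPowerSeries.algebraMap_apply]
      simp
    · intro d hd
      rw [Finset.coe_range, Set.mem_Iio]
      by_contra hdM
      refine hd ?_
      change _ • MvPowerSeries.coeff e (substX F ^ d) = 0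
      rw [MvPowerSeries.X_pow_dvd_iff.1 (pow_dvd_pow_of_dvd hX' d) e (by omega), smul_zero]
  have h3 := X_pow_dvd_substX h1
  rw [map_sub] at h3
  have := dvd_sub h3 h2
  rwa [sub_sub_sub_cancel_right] at this

theorem RootedProp.map_seq {R S : Type*} [CommRing R] [CommRing S] (f : R →+* S) (Q : RootedProp)
    (i : Fin 3) (z : Fin 3 → R) (n : ℕ) : f (Q.seq i z n) = Q.seq i (fun t => f (z t)) n := by
  unfold RootedProp.seq RootedProp.sum MarkedGraph.rootedSum
  simp only [map_sum, map_prod]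

/-- The composition of the block series with the series of the attached graphs. -/
theorem GraphClass.substX_egs_branch {𝒢 : GraphClass} (h𝒢 : 𝒢.BlockStable) (i : Fin 3)
    (z : Fin 3 → MvPowerSeries (Fin 3) ℚ) :
    substX (egs (𝒢.branch.seq i z)) =
      substX (egs (𝒢.block.seq i fun t => substX (𝒢.joinSeries z t))) := by
  refine eq_of_forall_X_pow_dvd fun M => ?_
  -- The variable marks the block vertices through `X ^ k` and the vertices of the attached graphs
  -- inside the weights; `substX` acts on both.
  let E : PowerSeries (MvPowerSeries (Fin 3) ℚ) := ∑ k ∈ Finset.range M,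
    PowerSeries.C (algebraMap ℚ _ (k ! : ℚ)⁻¹) * (PowerSeries.X ^ k *
      𝒢.block.seq i (𝒢.joinSeries z) k)
  have h1 : PowerSeries.X ^ M ∣ egs (𝒢.branch.seq i z) - E := by
    rw [PowerSeries.X_pow_dvd_iff]
    intro n hn
    rw [map_sub, coeff_egs_branch h𝒢, map_sum, sub_eq_zero]
    refine (Finset.sum_congr rfl fun k hk => ?_).trans
      (Finset.sum_subset (Finset.range_mono (Nat.succ_le_of_lt hn)) fun k _ hk => ?_)
    · rw [PowerSeries.coeff_C_mul, PowerSeries.coeff_X_pow_mul',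
        if_pos (Nat.lt_succ_iff.1 (Finset.mem_range.1 hk))]
    · rw [PowerSeries.coeff_C_mul, PowerSeries.coeff_X_pow_mul', if_neg, mul_zero]
      simpa using hk
  have h2 := X_pow_dvd_substX h1
  have h3 := X_pow_dvd_substXFun_sub
    (egs (𝒢.block.seq i fun t => substX (𝒢.joinSeries z t))) M
  have h4 : substX E = Polynomial.eval (MvPowerSeries.X 0)
      (PowerSeries.trunc M (egs (𝒢.block.seq i fun t => substX (𝒢.joinSeries z t)))) := by
    rw [eval_trunc_eq_sum, map_sum]
    refine Finset.sum_congr rfl fun k _ => ?_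
    rw [map_mul, map_mul, map_pow, substX_C, substX_X, RootedProp.map_seq, egs,
      PowerSeries.coeff_mk]
    ring
  rw [map_sub, h4] at h2
  have := dvd_sub h2 h3
  rwa [sub_sub_sub_cancel_right] at this

end SubstX

/-! ### From numbers of matched graphs to generating functions. -/

section Counting

variable {V : Type}

/-- The marked graph of a matched graph. -/
def Matched.toMarked (s : Matched V) : MarkedGraph V := ⟨s.graph, s.M.spanningCoe, s.I⟩

/-- The vertices of a matching are exactly the end points of its edges, so forgetting them loses
nothing. -/
theorem Matched.toMarked_injective : Function.Injective (Matched.toMarked (V := V)) := by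
  rintro ⟨g, I, M, h1, h2, h3⟩ ⟨g', I', M', h1', h2', h3'⟩ h
  obtain ⟨h4, h5, h6⟩ := MarkedGraph.mk.inj h
  simp only at h4 h5 h6
  subst h4 h6
  have hadj : M.Adj = M'.Adj := by
    funext u v
    exact congrFun (congrFun (congrArg SimpleGraph.Adj h5) u) v
  have hv : ∀ N : g.Subgraph, N.IsMatching → ∀ v, v ∈ N.verts ↔ ∃ w, N.Adj v w := fun N hN v =>
    ⟨fun hv => (hN hv).exists, fun ⟨w, hw⟩ => hw.fst_mem⟩
  obtain rfl : M = M' := by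
    refine SimpleGraph.Subgraph.ext ?_ hadj
    ext v
    rw [hv M h2, hv M' h2', hadj]
  rfl

theorem Matched.isMatchedOn_toMarked (s : Matched V) : s.toMarked.IsMatchedOn Set.univ where
  adj_mem _ _ _ := trivial
  le _ _ h := s.M.adj_sub h
  unique _ _ _ h h' := (s.matching h.fst_mem).unique h h'
  subset := Set.subset_univ _
  indep _ _ hu hv h := s.indep hu hv h.ne h
  disj _ _ hu h := Set.disjoint_left.1 s.disj hu h.fst_mem

theorem MarkedGraph.IsMatchedOn.exists_matched {t : MarkedGraph V} (ht : t.IsMatchedOn Set.univ) :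
    ∃ s : Matched V, s.toMarked = t := by
  refine ⟨⟨t.g, t.I, ⟨{v | ∃ w, t.m.Adj v w}, t.m.Adj, fun h => ht.le h, fun {v w} h => ⟨w, h⟩,
    t.m.symm⟩, ?_, ?_, ?_⟩, rfl⟩
  · intro u hu v hv _
    exact ht.indep u v hu hv
  · rintro v ⟨w, hw⟩
    exact ⟨w, hw, fun x hx => ht.unique _ _ _ hx hw⟩
  · rw [Set.disjoint_left]
    rintro v hv ⟨w, hw⟩
    exact ht.disj v w hv hw

theorem Matched.mem_part_iff (s : Matched V) (j : Fin 3) (v : V) :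
    v ∈ s.part j ↔ s.toMarked.typ v = j := by
  have h0 : s.toMarked.typ v = 0 ↔ v ∈ s.I := typ_eq_zero
  have h1 : s.toMarked.typ v = 1 ↔ v ∈ s.M.verts := by
    rw [s.isMatchedOn_toMarked.typ_eq_one]
    exact ⟨fun ⟨w, hw⟩ => SimpleGraph.Subgraph.Adj.fst_mem hw, fun hv => (s.matching hv).exists⟩
  have h2 : ∀ a : Fin 3, a = 2 ↔ ¬ (a = 0 ∨ a = 1) := by decide
  fin_cases j
  · exact h0.symm
  · exact h1.symm
  · change v ∈ (s.I ∪ s.M.verts)ᶜ ↔ s.toMarked.typ v = 2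
    rw [h2, h0, h1]
    rfl

open Classical in
theorem Matched.card_eq [Finite V] (p : MarkedGraph V → Prop) :
    Nat.card {s : Matched V // p s.toMarked} =
      (Finset.univ.filter fun t : MarkedGraph V => t.IsMatchedOn Set.univ ∧ p t).card := by
  rw [← Nat.card_eq_finsetCard]
  refine Nat.card_congr (Equiv.ofBijective (fun s => ⟨s.1.toMarked, Finset.mem_filter.2
    ⟨Finset.mem_univ _, s.1.isMatchedOn_toMarked, s.2⟩⟩) ⟨?_, ?_⟩)
  · intro s t h
    exact Subtype.ext (Matched.toMarked_injective (congrArg Subtype.val h))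
  · rintro ⟨t, ht⟩
    obtain ⟨-, h1, h2⟩ := Finset.mem_filter.1 ht
    obtain ⟨s, rfl⟩ := h1.exists_matched
    exact ⟨⟨s, h2⟩, rfl⟩

/-- The exponents of the monomial of a matched graph: the number of vertices in `A`, which is given
as the first argument, and the numbers of vertices of each type in `A`. -/
noncomputable def MarkedGraph.typeCount (s : MarkedGraph V) (n : ℕ) (A : Finset V) : Fin 4 →₀ ℕ :=
  Finsupp.equivFunOnFinite.symm
    (Fin.cons n fun j : Fin 3 => (A.filter fun v => s.typ v = j).card)

theorem MarkedGraph.typeCount_zero (s : MarkedGraph V) (n : ℕ) (A : Finset V) :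
    s.typeCount n A 0 = n := rfl

theorem MarkedGraph.typeCount_succ (s : MarkedGraph V) (n : ℕ) (A : Finset V) (j : Fin 3) :
    s.typeCount n A j.succ = (A.filter fun v => s.typ v = j).card := rfl

theorem MarkedGraph.typeCount_eq_iff (s : MarkedGraph V) {A : Finset V} {e : Fin 4 →₀ ℕ} :
    s.typeCount (e 0) A = e ↔ ∀ j : Fin 3, (A.filter fun v => s.typ v = j).card = e j.succ := by
  constructor
  · intro h j
    rw [← typeCount_succ s (e 0), h]
  · intro h
    ext j
    refine Fin.cases rfl (fun j => ?_) j
    rw [typeCount_succ, h]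

theorem prod_typ_eq {R : Type*} [CommRing R] (s : MarkedGraph V) (x : R) (y : Fin 3 → R)
    (n : ℕ) (A : Finset V) :
    (s.typeCount n A).prod (fun j k => (Fin.cons x y : Fin 4 → R) j ^ k) =
      x ^ n * ∏ v ∈ A, y (s.typ v) := by
  rw [Finsupp.prod_fintype _ _ fun _ => pow_zero _, Fin.prod_univ_succ, typeCount_zero,
    Fin.cons_zero, ← Finset.prod_fiberwise A fun v => s.typ v]
  congr 1
  refine Finset.prod_congr rfl fun j _ => ?_
  rw [typeCount_succ, Fin.cons_succ, Finset.prod_congr rfl fun v hv => by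
    rw [(Finset.mem_filter.1 hv).2], Finset.prod_const]

end Counting

open Classical in
/-- The matched graphs counted by `RootedProp.seq`. -/
noncomputable def RootedProp.set (Q : RootedProp) (i : Fin 3) (n : ℕ) :
    Finset (MarkedGraph (Fin (n + 1))) :=
  {s | s.IsMatchedOn (Finset.univ : Finset (Fin (n + 1))) ∧
    Q.holds (Finset.univ : Finset (Fin (n + 1))) (Fin.last n) s.g ∧ s.typ (Fin.last n) = i}

theorem RootedProp.seq_eq_sum (Q : RootedProp) {R : Type*} [CommRing R] (i : Fin 3) (z : Fin 3 → R)
    (n : ℕ) : Q.seq i z n =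
      ∑ s ∈ Q.set i n, ∏ v ∈ Finset.univ.erase (Fin.last n), z (s.typ v) := rfl

/-- `K` is the property `Q` of a graph with its last vertex as root. -/
def RootedProp.Represents (Q : RootedProp) (K : ∀ n : ℕ, SimpleGraph (Fin n) → Prop) : Prop :=
  ∀ n (g : SimpleGraph (Fin (n + 1))), K (n + 1) g ↔ Q.holds Set.univ (Fin.last n) g

theorem RootedProp.Represents.coeff_pointedEGF {Q : RootedProp}
    {K : ∀ n : ℕ, SimpleGraph (Fin n) → Prop} (hQ : Q.Represents K) (i : Fin 3) (e : Fin 4 →₀ ℕ) :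
    MvPowerSeries.coeff e (pointedEGF K i) =
      (((Q.set i (e 0)).filter fun s =>
        s.typeCount (e 0) (Finset.univ.erase (Fin.last (e 0))) = e).card : ℚ) / ((e 0)! : ℚ) := by
  classical
  change (Nat.card {s : Matched (Fin (e 0 + 1)) // _} : ℚ) / _ = _
  congr 2
  rw [RootedProp.set, Finset.filter_filter]
  simp only [typeCount_eq_iff, Finset.coe_univ]
  have key : ∀ s : Matched (Fin (e 0 + 1)), (K (e 0 + 1) s.graph ∧ Fin.last (e 0) ∈ s.part i ∧
      ∀ j : Fin 3, (s.part j \ {Fin.last (e 0)}).ncard = e j.succ) ↔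
      (Q.holds Set.univ (Fin.last (e 0)) s.toMarked.g ∧ s.toMarked.typ (Fin.last (e 0)) = i ∧
        ∀ j : Fin 3, ((Finset.univ.erase (Fin.last (e 0))).filter
          fun v => s.toMarked.typ v = j).card = e j.succ) := by
    intro s
    rw [hQ, s.mem_part_iff]
    refine and_congr Iff.rfl (and_congr Iff.rfl (forall_congr' fun j => ?_))
    rw [← Set.ncard_coe_finset]
    have : (s.part j \ {Fin.last (e 0)}) = (((Finset.univ.erase (Fin.last (e 0))).filter
          fun v => s.toMarked.typ v = j : Finset _) : Set _) := by
      ext v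
      simp [s.mem_part_iff, and_comm]
    rw [this]
  rw [Nat.card_congr (Equiv.subtypeEquivRight key), Matched.card_eq
    (fun t => Q.holds Set.univ (Fin.last (e 0)) t.g ∧ t.typ (Fin.last (e 0)) = i ∧
        ∀ j : Fin 3, ((Finset.univ.erase (Fin.last (e 0))).filter
          fun v => t.typ v = j).card = e j.succ)]
  congr 1
  ext s
  simp only [Finset.mem_filter, Finset.mem_univ, true_and, and_assoc]

/-- Substituting into the monomial of a graph gives `X 0 ^ n` times the product of its vertex
weights. Grouping the monomials by `n` and then by type counts identifies the two sums. -/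
theorem RootedProp.Represents.subst_pointedEGF {Q : RootedProp}
    {K : ∀ n : ℕ, SimpleGraph (Fin n) → Prop} (hQ : Q.Represents K) (i : Fin 3)
    (y : Fin 3 → MvPowerSeries (Fin 3) ℚ)
    (hy : MvPowerSeries.HasSubst (Fin.cons (MvPowerSeries.X 0) y :
      Fin 4 → MvPowerSeries (Fin 3) ℚ)) :
    MvPowerSeries.subst (Fin.cons (MvPowerSeries.X 0) y : Fin 4 → MvPowerSeries (Fin 3) ℚ)
      (pointedEGF K i) = substX (egs (Q.seq i y)) := by
  classical
  ext e
  set a : Fin 4 → MvPowerSeries (Fin 3) ℚ := Fin.cons (MvPowerSeries.X 0) y with ha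
  let h : (Fin 4 →₀ ℕ) → ℚ := fun d =>
    ((d 0)! : ℚ)⁻¹ * MvPowerSeries.coeff e (d.prod fun s k => a s ^ k)
  have hX : ∀ d : Fin 4 →₀ ℕ, e 0 < d 0 → h d = 0 := by
    intro d hd
    have : MvPowerSeries.coeff e (d.prod fun s k => a s ^ k) = 0 := by
      refine MvPowerSeries.X_pow_dvd_iff.1 ?_ e hd
      rw [Finsupp.prod_fintype _ _ fun _ => pow_zero _, Fin.prod_univ_succ]
      exact dvd_mul_right _ _
    simp only [h, this, mul_zero]
  let c : (n : ℕ) → MarkedGraph (Fin (n + 1)) → Fin 4 →₀ ℕ := fun n s =>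
    s.typeCount n (Finset.univ.erase (Fin.last n))
  have hterm : ∀ d : Fin 4 →₀ ℕ, MvPowerSeries.coeff d (pointedEGF K i) •
      MvPowerSeries.coeff e (d.prod fun s k => a s ^ k) =
      ((Q.set i (d 0)).filter fun s => c (d 0) s = d).card * h d := by
    intro d
    rw [hQ.coeff_pointedEGF, smul_eq_mul]
    simp only [h, c]
    ring
  -- Only finitely many monomials matter: an exponent of `x` above `e 0` is excluded by
  -- divisibility, and the other exponents are at most the number of vertices besides the root.
  let D : Finset (Fin 4 →₀ ℕ) := Finset.Iic (Finsupp.equivFunOnFinite.symm fun _ => e 0)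
  have hD : ∀ d, d ∈ D ↔ ∀ j, d j ≤ e 0 := fun d => by
    rw [Finset.mem_Iic, Finsupp.le_def]
    rfl
  have hc : ∀ n s j, c n s j ≤ n := by
    intro n s j
    refine Fin.cases le_rfl (fun j => ?_) j
    simp only [c, typeCount_succ]
    refine (Finset.card_filter_le _ fun v => s.typ v = j).trans ?_
    rw [Finset.card_erase_of_mem (Finset.mem_univ _), Finset.card_univ, Fintype.card_fin]
    omega
  rw [MvPowerSeries.coeff_subst hy, finsum_congr hterm,
    finsum_eq_sum_of_support_subset (s := D), coeff_substX _ (Nat.lt_succ_self (e 0)), map_sum,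
    ← Finset.sum_fiberwise_of_maps_to (s := D) (t := Finset.range (e 0 + 1))
      (g := fun d : Fin 4 →₀ ℕ => d 0)]
  · refine Finset.sum_congr rfl fun n hn => ?_
    have hn' : n ≤ e 0 := Nat.lt_succ_iff.1 (Finset.mem_range.1 hn)
    have hmaps : ∀ s ∈ Q.set i n, c n s ∈ D.filter fun d : Fin 4 →₀ ℕ => d 0 = n :=
      fun s _ => Finset.mem_filter.2 ⟨(hD _).2 fun j => (hc n s j).trans hn', rfl⟩
    have h1 : PowerSeries.coeff n (egs (Q.seq i y)) * MvPowerSeries.X 0 ^ n =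
        ∑ s ∈ Q.set i n, (n ! : ℚ)⁻¹ • ((c n s).prod fun s k => a s ^ k) := by
      rw [egs, PowerSeries.coeff_mk, Q.seq_eq_sum, Finset.mul_sum, Finset.sum_mul]
      refine Finset.sum_congr rfl fun s _ => ?_
      rw [ha, prod_typ_eq, Algebra.smul_def]
      ring
    rw [h1, map_sum, ← Finset.sum_fiberwise_of_maps_to (g := c n) hmaps]
    refine Finset.sum_congr rfl fun d hd => ?_
    obtain rfl := (Finset.mem_filter.1 hd).2
    rw [Finset.sum_congr rfl (g := fun _ => h d), Finset.sum_const, nsmul_eq_mul]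
    intro s hs
    rw [(Finset.mem_filter.1 hs).2, map_smul, smul_eq_mul]
  · intro d hd
    exact Finset.mem_range.2 (Nat.lt_succ_of_le ((hD d).1 hd 0))
  · intro d hd
    rw [Finset.mem_coe, hD]
    intro j
    by_contra hcon
    refine hd ?_
    by_cases hd0 : e 0 < d 0
    · simp only [hX d hd0, mul_zero]
    · beta_reduce
      rw [Finset.filter_false_of_mem, Finset.card_empty, Nat.cast_zero, zero_mul]
      intro s _ hs
      have := hc (d 0) s j
      rw [hs] at this
      omega

/-- Setting `z₂ = 0` is a substitution. -/
theorem evalZ2Zero_eq_subst (f : MvPowerSeries (Fin 4) ℚ)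
    (hy : MvPowerSeries.HasSubst (Fin.cons (MvPowerSeries.X 0)
      ![MvPowerSeries.X 1, MvPowerSeries.X 2, 0] : Fin 4 → MvPowerSeries (Fin 3) ℚ)) :
    evalZ2Zero f = MvPowerSeries.subst (Fin.cons (MvPowerSeries.X 0)
      ![MvPowerSeries.X 1, MvPowerSeries.X 2, 0] : Fin 4 → MvPowerSeries (Fin 3) ℚ) f := by
  classical
  ext e
  have hmap : ∀ j : Fin 3, e.mapDomain Fin.castSucc j.castSucc = e j := fun j =>
    Finsupp.mapDomain_apply (Fin.castSucc_injective 3) e j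
  have hlast : e.mapDomain Fin.castSucc (Fin.last 3) = 0 :=
    Finsupp.mapDomain_of_notMem_range _ _ (by simp)
  have hprod : ∀ d : Fin 4 →₀ ℕ, MvPowerSeries.coeff e (d.prod fun s k =>
      (Fin.cons (MvPowerSeries.X 0) ![MvPowerSeries.X 1, MvPowerSeries.X 2, 0] :
        Fin 4 → MvPowerSeries (Fin 3) ℚ) s ^ k) =
      if d = e.mapDomain Fin.castSucc then 1 else 0 := by
    intro d
    rw [Finsupp.prod_fintype _ _ fun _ => pow_zero _, Fin.prod_univ_four]
    change MvPowerSeries.coeff e (MvPowerSeries.X 0 ^ d 0 * MvPowerSeries.X 1 ^ d 1 *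
      MvPowerSeries.X 2 ^ d 2 * 0 ^ d 3) = _
    rcases Nat.eq_zero_or_pos (d 3) with h3 | h3
    · rw [h3, pow_zero, mul_one, MvPowerSeries.X_pow_eq, MvPowerSeries.X_pow_eq,
        MvPowerSeries.X_pow_eq, MvPowerSeries.monomial_mul_monomial,
        MvPowerSeries.monomial_mul_monomial, MvPowerSeries.coeff_monomial]
      simp only [mul_one]
      refine if_congr ?_ rfl rfl
      constructor
      · intro he
        ext j
        have h0 := congrFun (congrArg DFunLike.coe he)
        refine Fin.lastCases ?_ (fun j => ?_) j
        · rw [hlast]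
          exact h3
        · rw [hmap, h0 j]
          fin_cases j <;> simp
      · intro he
        ext j
        rw [← hmap, ← he]
        fin_cases j <;> simp
    · rw [zero_pow h3.ne', mul_zero, map_zero, if_neg]
      rintro rfl
      exact h3.ne' hlast
  rw [MvPowerSeries.coeff_subst hy, finsum_eq_single _ (e.mapDomain Fin.castSucc)]
  · rw [hprod, if_pos rfl, smul_eq_mul, mul_one]
    rfl
  · intro d hd
    rw [hprod, if_neg hd, smul_zero]

/-- Pointing a matched graph at a vertex of type `i` corresponds to differentiation. -/
theorem RootedProp.Represents.X_mul_pointedEGF {Q : RootedProp}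
    {K : ∀ n : ℕ, SimpleGraph (Fin n) → Prop} (hQ : Q.Represents K)
    (hroot : ∀ {V : Type} (A : Set V) (r r' : V) (g : SimpleGraph V),
      Q.holds A r g ↔ Q.holds A r' g) (i : Fin 3) :
    MvPowerSeries.X 0 * pointedEGF K i = MvPowerSeries.pderiv ℚ i.succ (matchedEGF K) := by
  classical
  ext e
  change Fin 4 →₀ ℕ at e
  rw [MvPowerSeries.coeff_pderiv]
  obtain ⟨e', he'⟩ : ∃ e' : Fin 4 →₀ ℕ, e' = e + Finsupp.single i.succ 1 := ⟨_, rfl⟩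
  have he0 : e' 0 = e 0 := by
    rw [he', Finsupp.add_apply, Finsupp.single_eq_of_ne (Fin.succ_ne_zero i).symm, add_zero]
  have hcoeff : ∀ n, e' 0 = n → MvPowerSeries.coeff e' (matchedEGF K) =
      ((Finset.univ.filter fun t : MarkedGraph (Fin n) => t.IsMatchedOn Set.univ ∧ K n t.g ∧
        ∀ j : Fin 3, (Finset.univ.filter fun v => t.typ v = j).card = e' j.succ).card : ℚ) /
        (n ! : ℚ) := by
    rintro n rfl
    change (Nat.card {s : Matched (Fin (e' 0)) // _} : ℚ) / _ = _
    congr 2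
    refine Eq.trans ?_ ((Matched.card_eq (fun t : MarkedGraph (Fin (e' 0)) => K (e' 0) t.g ∧
        ∀ j : Fin 3, (Finset.univ.filter fun v => t.typ v = j).card = e' j.succ)).trans
          (by congr))
    refine Nat.card_congr (Equiv.subtypeEquivRight fun s => and_congr Iff.rfl
      (forall_congr' fun j => ?_))
    rw [← Set.ncard_coe_finset]
    have : s.part j = ((Finset.univ.filter fun v => s.toMarked.typ v = j : Finset _) : Set _) := by
      ext v
      simp [s.mem_part_iff]
    rw [this]
  rw [← he']
  rcases hn : e 0 with _ | n
  -- Without vertices both sides vanish: the exponent of `zᵢ` in `e'` is positive, but there is no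
  -- vertex of type `i`.
  · rw [MvPowerSeries.X_dvd_iff.1 (dvd_mul_right _ _) e hn, hcoeff 0 (he0.trans hn),
      Finset.filter_false_of_mem]
    · simp
    · rintro t - ⟨-, -, h⟩
      have := h i
      rw [he', Finsupp.add_apply, Finsupp.single_eq_same, Finset.univ_eq_empty,
        Finset.filter_empty, Finset.card_empty] at this
      omega
  · rw [hcoeff (n + 1) (he0.trans hn)]
    set N : Finset (MarkedGraph (Fin (n + 1))) :=
      Finset.univ.filter fun t : MarkedGraph (Fin (n + 1)) => t.IsMatchedOn Set.univ ∧
        K (n + 1) t.g ∧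
        ∀ j : Fin 3, (Finset.univ.filter fun v => t.typ v = j).card = e' j.succ with hN
    -- Exchanging the labels `v` and `w` shows that every label has type `i` equally often.
    have hle : ∀ v w, (N.filter fun t => t.typ v = i).card ≤
        (N.filter fun t => t.typ w = i).card := by
      intro v w
      let f : Fin (n + 1) ↪ Fin (n + 1) := (Equiv.swap v w).toEmbedding
      have hf : f v = w := Equiv.swap_apply_left v w
      refine Finset.card_le_card_of_injOn (MarkedGraph.map f) ?_ (map_injective f).injOn
      intro t ht
      obtain ⟨ht, hv⟩ := Finset.mem_filter.1 ht
      obtain ⟨-, h1, h2, h3⟩ := Finset.mem_filter.1 ht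
      have huniv : f '' Set.univ = Set.univ := by
        rw [Set.image_univ]
        exact (Equiv.swap v w).surjective.range_eq
      refine Finset.mem_filter.2 ⟨Finset.mem_filter.2 ⟨Finset.mem_univ _, ?_, ?_, ?_⟩, ?_⟩
      · have := h1.map f
        rwa [huniv] at this
      · rw [hQ] at h2 ⊢
        rw [← Q.map_iff f, huniv] at h2
        exact (hroot _ _ _ _).1 h2
      · intro j
        rw [← h3 j]
        refine Eq.trans ?_ (Finset.card_map f)
        congr 1
        ext x
        obtain ⟨x, rfl⟩ := (Equiv.swap v w).surjective x
        change f x ∈ _ ↔ f x ∈ _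
        rw [Finset.mem_map']
        simp [typ_map]
      · rw [← hf, typ_map]
        exact hv
    have hcount : (n + 1) * (N.filter fun t => t.typ (Fin.last n) = i).card =
        N.card * (e i.succ + 1) := by
      -- Double counting of the pairs of a graph in `N` and a vertex of type `i` in it.
      have h1 : ∑ v : Fin (n + 1), (N.filter fun t => t.typ v = i).card =
          ∑ t ∈ N, (Finset.univ.filter fun v => t.typ v = i).card := by
        simp only [Finset.card_filter]
        exact Finset.sum_comm
      rw [Finset.sum_congr rfl fun v _ => le_antisymm (hle v (Fin.last n)) (hle (Fin.last n) v),
        Finset.sum_const, Finset.card_univ, Fintype.card_fin, smul_eq_mul] at h1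
      rw [h1, Finset.sum_congr rfl fun t ht => (Finset.mem_filter.1 ht).2.2.2 i,
        Finset.sum_const, smul_eq_mul, he', Finsupp.add_apply, Finsupp.single_eq_same]
    obtain ⟨d, hd⟩ : ∃ d : Fin 4 →₀ ℕ, e = Finsupp.single 0 1 + d :=
      exists_add_of_le (Finsupp.single_le_iff.2 (by omega))
    have hdn : d 0 = n := by
      have := congrFun (congrArg DFunLike.coe hd) 0
      rw [hn, Finsupp.add_apply, Finsupp.single_eq_same] at this
      omega
    have hds : ∀ j : Fin 3, d j.succ = e j.succ := fun j => by
      rw [hd, Finsupp.add_apply, Finsupp.single_eq_of_ne (Fin.succ_ne_zero j), zero_add]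
    have hset : ∀ m, d 0 = m → ((Q.set i (d 0)).filter fun s =>
        s.typeCount (d 0) (Finset.univ.erase (Fin.last (d 0))) = d).card =
        ((Finset.univ.filter fun t : MarkedGraph (Fin (m + 1)) => t.IsMatchedOn Set.univ ∧
          K (m + 1) t.g ∧
          ∀ j : Fin 3, (Finset.univ.filter fun v => t.typ v = j).card = e' j.succ).filter
            fun t => t.typ (Fin.last m) = i).card := by
      rintro m rfl
      congr 1
      ext t
      simp only [RootedProp.set, Finset.mem_filter, Finset.mem_univ, true_and, Finset.coe_univ,
        hQ _ t.g, and_assoc, typeCount_eq_iff]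
      refine and_congr_right fun _ => and_congr_right fun _ => ?_
      rw [and_comm]
      refine and_congr_left fun ht => forall_congr' fun j => ?_
      -- Discounting the root lowers only the number of vertices of type `i`, by the one that
      -- differentiation adds to the exponent.
      rw [Finset.filter_erase, Finset.card_erase_eq_ite, he', Finsupp.add_apply, hds j]
      simp only [Finset.mem_filter, Finset.mem_univ, true_and, ht]
      by_cases hij : i = j
      · subst hij
        have : 0 < (Finset.univ.filter fun v => t.typ v = i).card :=
          Finset.card_pos.2 ⟨Fin.last _, by simp [ht]⟩
        rw [if_pos rfl, Finsupp.single_eq_same]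
        omega
      · rw [if_neg hij, Finsupp.single_eq_of_ne (fun h => hij (Fin.succ_injective _ h).symm),
          add_zero]
    have hlhs : MvPowerSeries.coeff e (MvPowerSeries.X 0 * pointedEGF K i) =
        ((N.filter fun t => t.typ (Fin.last n) = i).card : ℚ) / (n ! : ℚ) := by
      rw [hd, MvPowerSeries.X, MvPowerSeries.coeff_add_monomial_mul, one_mul,
        hQ.coeff_pointedEGF, hset n hdn]
      rw [hdn]
    rw [hlhs, Nat.factorial_succ]
    have hq : ((n : ℚ) + 1) * ((N.filter fun t => t.typ (Fin.last n) = i).card : ℚ) =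
        (N.card : ℚ) * ((e i.succ : ℚ) + 1) := by exact_mod_cast hcount
    have hf : (n ! : ℚ) ≠ 0 := by exact_mod_cast n.factorial_ne_zero
    push_cast
    field_simp
    linear_combination hq

/-! ### The series of the theorem in terms of the weighted counts. -/

namespace GraphClass

variable {𝒢 : GraphClass}

theorem represents_block : 𝒢.block.Represents 𝒢.IsB := fun n g => by
  change 𝒢.mem (n + 1) g ∧ TwoConnected g ↔ g.TwoConnOn Set.univ ∧ 𝒢.Mem (g.induce Set.univ)
  rw [SimpleGraph.twoConnected_iff_twoConnOn_univ, and_comm,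
    mem_congr (SimpleGraph.induceUnivIso g), mem_fin_iff]

theorem represents_conn : 𝒢.conn.Represents 𝒢.IsC := fun n g => by
  change 𝒢.mem (n + 1) g ∧ g.Connected ↔ g.ConnOn Set.univ ∧ 𝒢.Mem (g.induce Set.univ)
  rw [SimpleGraph.connected_iff_connOn_univ, and_comm,
    mem_congr (SimpleGraph.induceUnivIso g), mem_fin_iff]

/-- The variables `z₀, z₁, 0`. -/
noncomputable def markVars : Fin 3 → MvPowerSeries (Fin 3) ℚ :=
  ![MvPowerSeries.X 1, MvPowerSeries.X 2, 0]

theorem hasSubst_markVars : MvPowerSeries.HasSubst (Fin.cons (MvPowerSeries.X 0) markVars :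
    Fin 4 → MvPowerSeries (Fin 3) ℚ) := by
  apply MvPowerSeries.hasSubst_of_constantCoeff_zero
  intro s
  fin_cases s <;> simp [markVars]

theorem CbarPt_eq (i : Fin 3) : 𝒢.CbarPt i = substX (egs (𝒢.conn.seq i markVars)) := by
  rw [CbarPt, evalZ2Zero_eq_subst _ hasSubst_markVars]
  exact represents_conn.subst_pointedEGF i markVars hasSubst_markVars

/-- The compatible pairs of types are (0,0), (1,2), (2,1) and (2,2); the last has weight `z₂ = 0`.
This is where the absence of marginal vertices other than the root enters. -/
theorem args_eq : 𝒢.args =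
    Fin.cons (MvPowerSeries.X 0) fun t => substX (𝒢.joinSeries markVars t) := by
  funext s
  refine Fin.cases rfl (fun t => ?_) s
  rw [Fin.cons_succ, joinSeries, map_sum]
  simp only [map_mul, substX_C, ← CbarPt_eq, Fin.sum_univ_three]
  fin_cases t <;> simp [args, joinWeight, CompatTypes, markVars]

theorem BbarSubst_eq (h𝒢 : 𝒢.BlockStable) (i : Fin 3) :
    𝒢.BbarSubst i = substX (egs (𝒢.branch.seq i markVars)) := by
  have h := 𝒢.hasSubst_args
  rw [BbarSubst, args_eq, substX_egs_branch h𝒢]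
  rw [args_eq] at h
  exact represents_block.subst_pointedEGF i _ h

theorem constantCoeff_egs_branch (i : Fin 3) :
    PowerSeries.constantCoeff (egs (𝒢.branch.seq i markVars)) = 0 := by
  rw [← PowerSeries.coeff_zero_eq_constantCoeff_apply, egs, PowerSeries.coeff_mk, branch_seq_zero,
    mul_zero]

end GraphClass

end

theorem mainTheorem6 (𝒢 : GraphClass) (h𝒢 : 𝒢.BlockStable) :
    (∀ i : Fin 3, MvPowerSeries.X 0 * 𝒢.BbarPt i = MvPowerSeries.pderiv ℚ i.succ 𝒢.Bbar) ∧
    (∀ i : Fin 3, MvPowerSeries.X 0 * 𝒢.CbarPt i =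
      evalZ2Zero (MvPowerSeries.pderiv ℚ i.succ 𝒢.Cbar)) ∧
    PowerSeries.HasSubst (𝒢.BbarSubst 0) ∧
    PowerSeries.HasSubst (𝒢.BbarSubst 2) ∧
    𝒢.CbarPt 0 = expSeries (𝒢.BbarSubst 0) ∧
    𝒢.CbarPt 1 = 𝒢.CbarPt 2 * 𝒢.BbarSubst 1 ∧
    𝒢.CbarPt 2 = expSeries (𝒢.BbarSubst 2) := by
  have hexp := fun i => substX_exp (GraphClass.constantCoeff_egs_branch (𝒢 := 𝒢) i)
  simp only [GraphClass.BbarSubst_eq h𝒢]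
  refine ⟨fun i => GraphClass.represents_block.X_mul_pointedEGF (fun _ _ _ _ => Iff.rfl) i,
    fun i => ?_, (hexp 0).2, (hexp 2).2, ?_, ?_, ?_⟩
  · have h := GraphClass.represents_conn (𝒢 := 𝒢).X_mul_pointedEGF (fun _ _ _ _ => Iff.rfl) i
    -- As a substitution fixing `X 0`, setting `z₂ = 0` commutes with multiplication by `X 0`.
    have heval : ∀ f, evalZ2Zero f = MvPowerSeries.subst
        (Fin.cons (MvPowerSeries.X 0) GraphClass.markVars) f := fun f =>
      evalZ2Zero_eq_subst f GraphClass.hasSubst_markVars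
    rw [GraphClass.Cbar, ← h, GraphClass.CbarPt, heval, heval,
      MvPowerSeries.subst_mul GraphClass.hasSubst_markVars,
      MvPowerSeries.subst_X GraphClass.hasSubst_markVars]
    rfl
  · rw [GraphClass.CbarPt_eq, GraphClass.egs_conn_eq_exp h𝒢 (by decide), (hexp 0).1]
  · rw [GraphClass.CbarPt_eq, GraphClass.CbarPt_eq, GraphClass.egs_conn_one h𝒢, map_mul, mul_comm]
  · rw [GraphClass.CbarPt_eq, GraphClass.egs_conn_eq_exp h𝒢 (by decide), (hexp 2).1]
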